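/- **Weights.** Let $\pi/2<a\le\pi$. Consider a function $L$ that is continuous on $[0,\infty)$ with values in $[1,\infty)$, eventually non-decreasing and unbounded there, and that is analytic and non-vanishing in the angle $S=\{s\ne 0:|\arg s|<a\}$. Put $\ell(t)=\log L(e^t)$ and $\varepsilon(s)=sL'(s)/L(s)$, and consider the conditions (R3) $\ell'$ is bounded from above near $+\infty$ and $\ell''(t)=o(\ell'(t))$ as $t\to+\infty$; (R8) $\varepsilon(s)=(1+o(1))\,\varepsilon(|s|)$ as $s\to\infty$, uniformly in $S$. A *Denjoy weight* is an unbounded function of the form $$L(s)=e^{\log^{\alpha_0}(s+1)}\prod_{k\ge1}\log_k^{\alpha_k}\bigl(s+\exp_k(1)\bigr),$$ where $\alpha_k\ge0$, only finitely many $\alpha_k$ are nonzero, $\alpha_0<1$, $\log_k$ and $\exp_k$ are the $k$-th iterates of $\log$ and $\exp$, and principal branches are used. **Transforms and classes.** Put $\gamma(s)=L(s)^s$ (the branch of $\log L$ that is real on the positive ray), and $$E(z)=\sum_{n\ge0}\frac{z^n}{\gamma(n+1)},\qquad K(t)=\frac1{2\pi i}\int_{c-i\infty}^{c+i\infty}t^{-s}\gamma(s)\,ds\quad(t>0,\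 c>0),\qquad R_LF(x)=\int_0^\infty F(xt)K(t)\,dt .$$ For an interval $I\ni0$, $A(L;I)$ is the set of entire functions $F$ such that, for every $Y>0$, $\max_{|v|\le Y}|F(u+iv)|=O(E(u/c_+))$ as $u\to+\infty$ for every $c_+\in I\cap(0,\infty)$, and $\max_{|v|\le Y}|F(u+iv)|=O(E(u/c_-))$ as $u\to-\infty$ for every $c_-\in I\cap(-\infty,0)$. The Beurling class $C_0(L;I)$ is the set of $f\in C^\infty(I)$ such that for every compact interval $J\subseteq I$ and every $\delta>0$ there is $C>0$ with $\max_J|f^{(n)}|\le C(\delta nL(n))^n$ for all $n\ge0$ (with $0^0=1$; derivatives at an endpoint of $I$ belonging to $I$ are one-sided). **Theorem 1.** Suppose that $L$ is a Denjoy weight, or more generally that $L$ is a weight as above satisfying (R3) and (R8). Let $I$ be a non-degenerate interval containing $0$ such that $I\cap(0,\infty)$ and $I\cap(-\infty,0)$ are open. Then for every $c>0$ the integral defining $K$ converges absolutely, and for every $F\in A(L;I)$ the integral $R_LF(x)$ converges absolutely for every $x\in I$ and $R_LF\in C_0(L;I)$; that is, the regular transform $R_L$ maps $A(L;I)$ into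 $C_0(L;I)$. -/

import Mathlib

open Real Set Filter Topology MeasureTheory Asymptotics
open scoped ContDiff

noncomputable section

namespace RegularTransform

/-- The open angle `{s : |arg s| < a}`, with its vertex removed. -/
def angle (a : ℝ) : Set ℂ := {s | s ≠ 0 ∧ |s.arg| < a}

/-- The real function `ρ ↦ L ρ` on the real line underlying a complex weight `L`
(only its values on `[0, ∞)` matter). -/
def trace (L : ℂ → ℂ) (ρ : ℝ) : ℝ := (L (ρ : ℂ)).re

/-- `ε(s) = s L'(s) / L(s)`. -/
def eps (L : ℂ → ℂ) (s : ℂ) : ℂ := s * deriv L s / L s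

/-- `ℓ(t) = log L(e^t)`. -/
def ell (L : ℂ → ℂ) (t : ℝ) : ℝ := Real.log (trace L (Real.exp t))

/-- Standing assumptions on a weight: it maps `[0, ∞)` continuously into `[1, ∞)`, is eventually
increasing and unbounded there, and is analytic and non-vanishing in the angle `|arg s| < a`. -/
structure IsWeight (a : ℝ) (L : ℂ → ℂ) : Prop where
  im_eq_zero : ∀ ρ : ℝ, 0 ≤ ρ → (L (ρ : ℂ)).im = 0
  one_le : ∀ ρ : ℝ, 0 ≤ ρ → 1 ≤ trace L ρ
  continuousOn : ContinuousOn (trace L) (Ici 0)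
  eventually_mono : ∃ ρ₀ : ℝ, MonotoneOn (trace L) (Ici ρ₀)
  unbounded : Tendsto (trace L) atTop atTop
  analytic : DifferentiableOn ℂ L (angle a)
  ne_zero : ∀ s ∈ angle a, L s ≠ 0

/-- `ℓ'` is bounded from above and `ℓ''(t) = o(ℓ'(t))` as `t → +∞`. -/
def R3 (L : ℂ → ℂ) : Prop :=
  (∃ M : ℝ, ∀ᶠ t in atTop, deriv (ell L) t ≤ M) ∧
    (fun t => deriv (deriv (ell L)) t) =o[atTop] (fun t => deriv (ell L) t)

/-- `ε(s) = (1 + o(1)) ε(|s|)` uniformly in `|arg s| < a` as `s → ∞`. -/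
def R8 (a : ℝ) (L : ℂ → ℂ) : Prop :=
  (fun s : ℂ => eps L s - eps L ((‖s‖ : ℝ) : ℂ))
    =o[Bornology.cobounded ℂ ⊓ 𝓟 (angle a)] (fun s : ℂ => eps L ((‖s‖ : ℝ) : ℂ))

/-- The Denjoy function with multi-index `α`:
`exp (log^{α₀}(s + 1)) * ∏_{k ≥ 1} log_k^{α_k}(s + exp_k 1)`, principal branches. -/
def denjoy (α : ℕ →₀ ℝ) (s : ℂ) : ℂ :=
  Complex.exp (Complex.log (s + 1) ^ ((α 0 : ℝ) : ℂ)) *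
    ∏ k ∈ α.support.erase 0,
      ((Complex.log)^[k] (s + (((Real.exp)^[k] 1 : ℝ) : ℂ))) ^ ((α k : ℝ) : ℂ)

/-- Denjoy weights. The condition `α ≠ 0` excludes the constant function `e`, as weights are
unbounded. -/
def IsDenjoyWeight (L : ℂ → ℂ) : Prop :=
  ∃ α : ℕ →₀ ℝ, (∀ k, 0 ≤ α k) ∧ α 0 < 1 ∧ α ≠ 0 ∧ L = denjoy α

/-- The analytic branch of `log L` in an angle around the positive ray that is real on this ray:
`log L(|s|)` plus the integral of `L'/L` along the circular arc from `|s|` to `s`. -/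
def logBranch (L : ℂ → ℂ) (s : ℂ) : ℂ :=
  (Real.log (trace L ‖s‖) : ℂ) +
    Complex.I * ∫ ψ in (0 : ℝ)..s.arg, eps L ((‖s‖ : ℂ) * Complex.exp (ψ * Complex.I))

/-- `γ(s) = L(s)^s`. -/
def gam (L : ℂ → ℂ) (s : ℂ) : ℂ := Complex.exp (s * logBranch L s)

/-- The kernel `K(t) = (2πi)⁻¹ ∫_{c-i∞}^{c+i∞} t^{-s} γ(s) ds`. -/
def kernel (L : ℂ → ℂ) (c : ℝ) (t : ℝ) : ℂ := mellinInv c (gam L) t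

/-- The regular transform `x ↦ ∫_0^∞ F(xt) K(t) dt`. -/
def regularTransform (L : ℂ → ℂ) (c : ℝ) (F : ℂ → ℂ) (x : ℝ) : ℂ :=
  ∫ t in Ioi (0 : ℝ), F ((x * t : ℝ) : ℂ) * kernel L c t

/-- `E(x) = ∑ xⁿ / γ(n+1)`, where `γ(n) = w(n)ⁿ`. -/
def entireE (w : ℝ → ℝ) (x : ℝ) : ℝ :=
  ∑' n : ℕ, x ^ n / w ((n : ℝ) + 1) ^ (n + 1)

/-- The class `A(w; I)` of entire functions. The bound on the right (left) is imposed for each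
positive (negative) point of `I`. -/
def classA (w : ℝ → ℝ) (I : Set ℝ) : Set (ℂ → ℂ) :=
  {F | Differentiable ℂ F ∧ ∀ Y : ℝ, 0 < Y →
    (∀ c ∈ I, 0 < c → ∃ C : ℝ, ∀ᶠ u : ℝ in atTop, ∀ v : ℝ, |v| ≤ Y →
      ‖F ((u : ℂ) + v * Complex.I)‖ ≤ C * entireE w (u / c)) ∧
    (∀ c ∈ I, c < 0 → ∃ C : ℝ, ∀ᶠ u : ℝ in atBot, ∀ v : ℝ, |v| ≤ Y →
      ‖F ((u : ℂ) + v * Complex.I)‖ ≤ C * entireE w (u / c))}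

/-- The Beurling class `C₀(w; I)`; derivatives at an endpoint belonging to `I` are one-sided. -/
def beurlingClass (w : ℝ → ℝ) (I : Set ℝ) : Set (ℝ → ℂ) :=
  {f | ContDiffOn ℝ ∞ f I ∧ ∀ a b : ℝ, Icc a b ⊆ I → ∀ δ : ℝ, 0 < δ →
    ∃ C : ℝ, 0 < C ∧ ∀ n : ℕ, ∀ x ∈ Icc a b,
      ‖iteratedDerivWithin n f I x‖ ≤ C * (δ * n * w n) ^ n}

end RegularTransform

end

/-!
The kernel is an integral over a vertical line, so only the right half-plane matters, and there a
weight is controlled by `ε(s) = s L'(s) / L(s)`. Three facts about `ε` suffice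
(`IsHalfPlaneWeight`): it is bounded on the positive ray, it does not decay faster than `r ^ (-1/2)`
there, and `ε(s) = (1 + o(1)) ε(‖s‖)` uniformly in the half-plane. For a general weight the lower
bound follows from `ℓ'' = o(ℓ')`, since `ℓ'(t) e^{t/2}` is eventually increasing. For a Denjoy
weight `ε` is an explicit positive combination of products of powers of iterated logarithms, each
uniformly asymptotic to its values on the ray.

Along a vertical line `log |γ|` has derivative `-Im (log L + ε)`, which is `-(arg s) ε(‖s‖)` up to a
small multiple of `ε(‖s‖)`. Hence `|γ(σ + iy)| ≤ C e^{ησ} γ(σ) e^{-κ √|y|}` for every `η > 0`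
(`exists_norm_gam_vertical_le`). The integral for the kernel therefore converges absolutely, its
line may be moved to any abscissa `σ > 0`, and `|K(t)| ≤ C e^{ησ} γ(σ) t^{-σ}`
(`exists_norm_kernel_le`).

The product of `E(q t)`, `q < 1`, with the kernel is small, and no saddle-point asymptotics are
needed to see it. The term of index `m` of the power series of `E` is multiplied by
`t ^ n K(t)`, and the kernel is bounded with `σ = n + m + 2`. What remains is the quotient
`γ(n + m + 2) / γ(m + 1)`, which is at most `L(n) ^ n` up to exponential factors because `ε` is
bounded; the factor `q ^ m` makes the sum over `m` converge. This gives
`t ^ n E(q t) |K(t)| ≤ C (A L(n)) ^ n g(t)` with `g` integrable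
(`exists_pow_mul_entireE_mul_norm_kernel_le`).

For `F` in the class `A(L; I)` and `x` in a compact subinterval, Cauchy's estimates on discs of
radius `Y` give `|F^{(n)}(x t)| ≤ C n! Y ^ {-n} E(q t)`, with `q < 1` independent of `Y` because `I`
has room beyond the subinterval. The transform may thus be differentiated under the integral sign,
and its `n`-th derivative is at most `C n! (A / Y) ^ n L(n) ^ n` with `A` independent of `Y`. As `Y`
is arbitrary, this is the Beurling condition.
-/

noncomputable section

namespace RegularTransform

/-! ### Weights on the right half-plane -/

/-- The open right half-plane. Only the behaviour of a weight there matters for the kernel. -/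
def halfPlane : Set ℂ := {s | 0 < s.re}

/-- The properties of a weight on which the mapping theorem rests. They concern the right half-plane
only, and they follow both from the assumptions `R3`, `R8` on a general weight and from the
formula for a Denjoy weight. The lower bound on `ε` is a weak form of slow variation. -/
structure IsHalfPlaneWeight (L : ℂ → ℂ) : Prop where
  im_eq_zero : ∀ r : ℝ, 0 < r → (L r).im = 0
  one_le : ∀ r : ℝ, 0 < r → 1 ≤ trace L r
  unbounded : Tendsto (trace L) atTop atTop
  analytic : DifferentiableOn ℂ L halfPlane
  ne_zero : ∀ s ∈ halfPlane, L s ≠ 0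
  eps_le : ∃ M : ℝ, 0 ≤ M ∧ ∀ᶠ r : ℝ in atTop, (eps L r).re ≤ M
  le_eps : ∃ κ : ℝ, 0 < κ ∧ ∀ᶠ r : ℝ in atTop, κ / √r ≤ (eps L r).re
  eps_sub : ∀ η : ℝ, 0 < η → ∃ R : ℝ, ∀ s ∈ halfPlane, R ≤ ‖s‖ →
    ‖eps L s - eps L (‖s‖ : ℝ)‖ ≤ η * (eps L (‖s‖ : ℝ)).re

lemma isOpen_halfPlane : IsOpen halfPlane := isOpen_lt continuous_const Complex.continuous_re

lemma ofReal_mem_halfPlane {r : ℝ} (hr : 0 < r) : (r : ℂ) ∈ halfPlane := by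
  simpa [halfPlane] using hr

namespace IsHalfPlaneWeight

variable {L : ℂ → ℂ}

lemma trace_pos (hL : IsHalfPlaneWeight L) {r : ℝ} (hr : 0 < r) : 0 < trace L r :=
  one_pos.trans_le (hL.one_le r hr)

lemma ofReal_trace (hL : IsHalfPlaneWeight L) {r : ℝ} (hr : 0 < r) : (trace L r : ℂ) = L r := by
  apply Complex.ext <;> simp [trace, hL.im_eq_zero r hr]

end IsHalfPlaneWeight

section Analytic

variable {L : ℂ → ℂ}

lemma hasDerivAt_of_mem_halfPlane (hL : DifferentiableOn ℂ L halfPlane) {s : ℂ}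
    (hs : s ∈ halfPlane) : HasDerivAt L (deriv L s) s :=
  (hL.differentiableAt (isOpen_halfPlane.mem_nhds hs)).hasDerivAt

lemma hasDerivAt_trace (hL : DifferentiableOn ℂ L halfPlane) {r : ℝ} (hr : 0 < r) :
    HasDerivAt (trace L) (deriv L r).re r :=
  (hasDerivAt_of_mem_halfPlane hL (ofReal_mem_halfPlane hr)).real_of_complex

lemma deriv_im_eq_zero (hL : DifferentiableOn ℂ L halfPlane)
    (him : ∀ r : ℝ, 0 < r → (L r).im = 0) {r : ℝ} (hr : 0 < r) : (deriv L r).im = 0 := by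
  have h1 : HasDerivAt (fun x : ℝ => L x) (deriv L r) r :=
    (hasDerivAt_of_mem_halfPlane hL (ofReal_mem_halfPlane hr)).comp_ofReal
  have h2 := (hasDerivAt_trace hL hr).ofReal_comp
  have h3 : (fun x : ℝ => L x) =ᶠ[𝓝 r] fun x : ℝ => (trace L x : ℂ) := by
    filter_upwards [lt_mem_nhds hr] with x hx
    apply Complex.ext <;> simp [trace, him x hx]
  have h4 := h1.unique (h2.congr_of_eventuallyEq h3)
  rw [h4]; simp

lemma eps_ofReal (hL : DifferentiableOn ℂ L halfPlane)
    (him : ∀ r : ℝ, 0 < r → (L r).im = 0) {r : ℝ} (hr : 0 < r) :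
    eps L r = ((r * (deriv L r).re / trace L r : ℝ) : ℂ) := by
  have h1 : L r = (trace L r : ℂ) := by apply Complex.ext <;> simp [trace, him r hr]
  have h2 : deriv L r = ((deriv L r).re : ℂ) := by
    apply Complex.ext <;> simp [deriv_im_eq_zero hL him hr]
  rw [eps, h1]
  nth_rewrite 1 [h2]
  push_cast
  rfl

lemma continuousOn_eps (hL : DifferentiableOn ℂ L halfPlane) (h0 : ∀ s ∈ halfPlane, L s ≠ 0) :
    ContinuousOn (eps L) halfPlane :=
  (continuousOn_id.mul (hL.deriv isOpen_halfPlane).continuousOn).div hL.continuousOn h0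

end Analytic

/-! ### The analytic logarithm of a weight -/

/-- Discs touching the imaginary axis at the origin exhaust the half-plane. -/
lemma mem_ball_iff_norm_sq_lt {R : ℝ} (hR : 0 < R) (s : ℂ) :
    s ∈ Metric.ball (R : ℂ) R ↔ ‖s‖ ^ 2 < 2 * R * s.re := by
  rw [Metric.mem_ball, dist_eq_norm, ← abs_of_pos hR, ← abs_of_nonneg (norm_nonneg (s - _)),
    ← sq_lt_sq, abs_of_pos hR, ← Complex.normSq_eq_norm_sq, ← Complex.normSq_eq_norm_sq,
    Complex.normSq_apply, Complex.normSq_apply]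
  simp only [Complex.sub_re, Complex.ofReal_re, Complex.sub_im, Complex.ofReal_im, sub_zero]
  constructor <;> intro h <;> nlinarith

lemma ball_subset_halfPlane {R : ℝ} (hR : 0 < R) : Metric.ball (R : ℂ) R ⊆ halfPlane := by
  intro s hs
  rw [mem_ball_iff_norm_sq_lt hR] at hs
  have h : 0 < 2 * R * s.re := (sq_nonneg _).trans_lt hs
  exact pos_of_mul_pos_right h (by positivity)

lemma polar_re (r ψ : ℝ) : ((r : ℂ) * Complex.exp (ψ * Complex.I)).re = r * cos ψ := by
  rw [Complex.re_ofReal_mul, Complex.exp_ofReal_mul_I_re]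

lemma norm_polar {r : ℝ} (hr : 0 ≤ r) (ψ : ℝ) :
    ‖(r : ℂ) * Complex.exp (ψ * Complex.I)‖ = r := by
  rw [norm_mul, Complex.norm_exp_ofReal_mul_I, mul_one, Complex.norm_real, norm_of_nonneg hr]

lemma abs_arg_lt_of_mem_halfPlane {s : ℂ} (hs : s ∈ halfPlane) : |s.arg| < π / 2 :=
  Complex.abs_arg_lt_pi_div_two_iff.2 (Or.inl hs)

lemma norm_pos_of_mem_halfPlane {s : ℂ} (hs : s ∈ halfPlane) : 0 < ‖s‖ :=
  norm_pos_iff.2 fun h => by simp [halfPlane, h] at hs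

lemma abs_le_of_mem_uIcc_zero {θ ψ : ℝ} (hψ : ψ ∈ uIcc 0 θ) : |ψ| ≤ |θ| := by
  rcases mem_uIcc.1 hψ with h | h
  · rw [abs_of_nonneg h.1, abs_of_nonneg (h.1.trans h.2)]; exact h.2
  · rw [abs_of_nonpos h.2, abs_of_nonpos (h.1.trans h.2)]; linarith [h.1]

/-- On the arc from `‖s‖` to `s` the real part is at least that of `s`. -/
lemma re_le_re_arc {s : ℂ} (hs : s ∈ halfPlane) {ψ : ℝ} (hψ : ψ ∈ uIcc 0 s.arg) :
    s.re ≤ ((‖s‖ : ℂ) * Complex.exp (ψ * Complex.I)).re := by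
  rw [polar_re, ← Complex.norm_mul_cos_arg s, ← cos_abs s.arg, ← cos_abs ψ]
  refine mul_le_mul_of_nonneg_left (cos_le_cos_of_nonneg_of_le_pi (abs_nonneg _) ?_
    (abs_le_of_mem_uIcc_zero hψ)) (norm_nonneg s)
  linarith [abs_arg_lt_of_mem_halfPlane hs, pi_pos]

lemma arc_mem_halfPlane {s : ℂ} (hs : s ∈ halfPlane) {ψ : ℝ} (hψ : ψ ∈ uIcc 0 s.arg) :
    (‖s‖ : ℂ) * Complex.exp (ψ * Complex.I) ∈ halfPlane :=
  lt_of_lt_of_le (show 0 < s.re from hs) (re_le_re_arc hs hψ)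

lemma continuousOn_eps_arc {L : ℂ → ℂ} (hL : IsHalfPlaneWeight L) {s : ℂ} (hs : s ∈ halfPlane) :
    ContinuousOn (fun ψ : ℝ => eps L ((‖s‖ : ℂ) * Complex.exp (ψ * Complex.I)))
      (uIcc 0 s.arg) :=
  (continuousOn_eps hL.analytic hL.ne_zero).comp (by fun_prop) fun _ hψ => arc_mem_halfPlane hs hψ

lemma logBranch_ofReal (L : ℂ → ℂ) {r : ℝ} (hr : 0 < r) :
    logBranch L r = (Real.log (trace L r) : ℂ) := by
  simp [logBranch, Complex.arg_ofReal_of_nonneg hr.le, abs_of_pos hr]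

/-- On each disc touching the imaginary axis at the origin, `logBranch L` is the primitive of
`L' / L` that is real on the positive ray. -/
lemma exists_primitive_eqOn_logBranch {L : ℂ → ℂ} (hL : IsHalfPlaneWeight L) {R : ℝ}
    (hR : 0 < R) : ∃ G : ℂ → ℂ, (∀ s ∈ Metric.ball (R : ℂ) R, HasDerivAt G (deriv L s / L s) s) ∧
      EqOn (logBranch L) G (Metric.ball (R : ℂ) R) := by
  have hsub := ball_subset_halfPlane hR
  have hd : DifferentiableOn ℂ (fun s => deriv L s / L s) (Metric.ball (R : ℂ) R) :=
    ((hL.analytic.deriv isOpen_halfPlane).div hL.analytic hL.ne_zero).mono hsub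
  obtain ⟨G, hG0, hG⟩ := hd.isExactOn_ball.with_val_at (R : ℂ) (Real.log (trace L R) : ℂ)
  refine ⟨G, hG, ?_⟩
  have hmemR : ∀ r : ℝ, r ∈ Ioo 0 (2 * R) → (r : ℂ) ∈ Metric.ball (R : ℂ) R := by
    intro r hr
    rw [mem_ball_iff_norm_sq_lt hR, Complex.norm_real, norm_of_nonneg hr.1.le, Complex.ofReal_re]
    nlinarith [hr.1, hr.2]
  have hder : ∀ r ∈ Ioo 0 (2 * R),
      HasDerivAt (fun x : ℝ => G x - (Real.log (trace L x) : ℂ)) 0 r := by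
    intro r hr
    have h1 := (hG r (hmemR r hr)).comp_ofReal
    have h2 := ((hasDerivAt_trace hL.analytic hr.1).log (hL.trace_pos hr.1).ne').ofReal_comp
    refine (h1.sub h2).congr_deriv ?_
    have h3 : deriv L r = ((deriv L r).re : ℂ) := by
      apply Complex.ext <;> simp [deriv_im_eq_zero hL.analytic hL.im_eq_zero hr.1]
    rw [← hL.ofReal_trace hr.1]
    nth_rewrite 1 [h3]
    push_cast
    simp
  have hreal : ∀ r ∈ Ioo 0 (2 * R), G r = (Real.log (trace L r) : ℂ) := by
    intro r hr
    have h := isOpen_Ioo.is_const_of_deriv_eq_zero isPreconnected_Ioo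
      (fun x hx => (hder x hx).differentiableAt.differentiableWithinAt)
      (fun x hx => (hder x hx).deriv) hr (show R ∈ Ioo 0 (2 * R) from ⟨hR, by linarith⟩)
    simp only [hG0, sub_self] at h
    exact sub_eq_zero.1 h
  intro s hs
  have hsH := hsub hs
  have hn := norm_pos_of_mem_halfPlane hsH
  have hs' := (mem_ball_iff_norm_sq_lt hR s).1 hs
  have hre : s.re ≤ ‖s‖ := Complex.re_le_norm s
  have hnR : ‖s‖ ∈ Ioo 0 (2 * R) := by
    refine ⟨hn, ?_⟩
    have : ‖s‖ * ‖s‖ < 2 * R * ‖s‖ := by nlinarith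
    exact lt_of_mul_lt_mul_right this hn.le
  have harc : ∀ ψ ∈ uIcc 0 s.arg,
      HasDerivAt (fun ψ : ℝ => G ((‖s‖ : ℂ) * Complex.exp (ψ * Complex.I)))
        (Complex.I * eps L ((‖s‖ : ℂ) * Complex.exp (ψ * Complex.I))) ψ := by
    intro ψ hψ
    have hmem : (‖s‖ : ℂ) * Complex.exp (ψ * Complex.I) ∈ Metric.ball (R : ℂ) R := by
      rw [mem_ball_iff_norm_sq_lt hR, norm_polar hn.le]
      nlinarith [re_le_re_arc hsH hψ]
    have h1 : HasDerivAt (fun ψ : ℂ => (‖s‖ : ℂ) * Complex.exp (ψ * Complex.I))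
        ((‖s‖ : ℂ) * (Complex.exp (ψ * Complex.I) * (1 * Complex.I))) (ψ : ℂ) :=
      (((hasDerivAt_id (ψ : ℂ)).mul_const Complex.I).cexp).const_mul _
    have h2 := ((hG _ hmem).comp (ψ : ℂ) h1).comp_ofReal
    refine h2.congr_deriv ?_
    rw [eps]
    ring
  have hint := intervalIntegral.integral_eq_sub_of_hasDerivAt harc
    ((continuousOn_const.mul (continuousOn_eps_arc hL hsH)).intervalIntegrable)
  rw [intervalIntegral.integral_const_mul, Complex.norm_mul_exp_arg_mul_I] at hint
  simp only [Complex.ofReal_zero, zero_mul, Complex.exp_zero, mul_one, hreal _ hnR] at hint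
  rw [logBranch, hint]
  ring

lemma hasDerivAt_logBranch {L : ℂ → ℂ} (hL : IsHalfPlaneWeight L) {s : ℂ} (hs : s ∈ halfPlane) :
    HasDerivAt (logBranch L) (deriv L s / L s) s := by
  have hre : 0 < s.re := hs
  have hn := norm_pos_of_mem_halfPlane hs
  have hR : 0 < ‖s‖ ^ 2 / s.re := by positivity
  have hmem : s ∈ Metric.ball ((‖s‖ ^ 2 / s.re : ℝ) : ℂ) (‖s‖ ^ 2 / s.re) := by
    rw [mem_ball_iff_norm_sq_lt hR, mul_assoc, div_mul_cancel₀ _ hre.ne']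
    nlinarith [pow_pos hn 2]
  obtain ⟨G, hG, heq⟩ := exists_primitive_eqOn_logBranch hL hR
  exact (hG s hmem).congr_of_eventuallyEq
    (heq.eventuallyEq_of_mem (Metric.isOpen_ball.mem_nhds hmem))

lemma hasDerivAt_mul_logBranch {L : ℂ → ℂ} (hL : IsHalfPlaneWeight L) {s : ℂ}
    (hs : s ∈ halfPlane) :
    HasDerivAt (fun s => s * logBranch L s) (logBranch L s + eps L s) s := by
  refine ((hasDerivAt_id s).mul (hasDerivAt_logBranch hL hs)).congr_deriv ?_
  simp only [id, one_mul, eps]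
  ring

lemma differentiableOn_gam {L : ℂ → ℂ} (hL : IsHalfPlaneWeight L) :
    DifferentiableOn ℂ (gam L) halfPlane := fun _ hs =>
  (hasDerivAt_mul_logBranch hL hs).cexp.differentiableAt.differentiableWithinAt

/-- The variation of the argument of `L` along an arc is governed by the value of `ε` at the real
endpoint of the arc. -/
lemma abs_im_logBranch_sub_le {L : ℂ → ℂ} (hL : IsHalfPlaneWeight L) {η R : ℝ}
    (hR : ∀ s ∈ halfPlane, R ≤ ‖s‖ → ‖eps L s - eps L (‖s‖ : ℝ)‖ ≤ η * (eps L (‖s‖ : ℝ)).re)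
    {s : ℂ} (hs : s ∈ halfPlane) (hRs : R ≤ ‖s‖) :
    |(logBranch L s).im - s.arg * (eps L (‖s‖ : ℝ)).re| ≤
      η * (eps L (‖s‖ : ℝ)).re * |s.arg| := by
  have hn := norm_pos_of_mem_halfPlane hs
  have hint := (continuousOn_eps_arc hL hs).intervalIntegrable (μ := volume)
  have h1 : ‖∫ ψ in (0 : ℝ)..s.arg, (eps L ((‖s‖ : ℂ) * Complex.exp (ψ * Complex.I)) -
      eps L (‖s‖ : ℝ))‖ ≤ η * (eps L (‖s‖ : ℝ)).re * |s.arg - 0| := by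
    refine intervalIntegral.norm_integral_le_of_norm_le_const fun ψ hψ => ?_
    have h := hR _ (arc_mem_halfPlane hs (uIoc_subset_uIcc hψ)) (by rwa [norm_polar hn.le])
    rwa [norm_polar hn.le] at h
  rw [intervalIntegral.integral_sub hint (by simp), intervalIntegral.integral_const, sub_zero] at h1
  refine le_trans ?_ h1
  refine le_trans (le_of_eq ?_) (Complex.abs_re_le_norm _)
  simp [logBranch]

/-! ### Decay of `γ` along vertical lines -/

variable {L : ℂ → ℂ}

/-- The logarithm of `|γ|`. -/
def logGam (L : ℂ → ℂ) (s : ℂ) : ℝ := (s * logBranch L s).re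

lemma norm_gam (L : ℂ → ℂ) (s : ℂ) : ‖gam L s‖ = exp (logGam L s) := Complex.norm_exp _

lemma logGam_ofReal (L : ℂ → ℂ) {r : ℝ} (hr : 0 < r) :
    logGam L r = r * Real.log (trace L r) := by
  rw [logGam, logBranch_ofReal L hr, ← Complex.ofReal_mul, Complex.ofReal_re]

lemma continuousOn_logGam (hL : IsHalfPlaneWeight L) : ContinuousOn (logGam L) halfPlane :=
  Complex.continuous_re.comp_continuousOn fun _ hs =>
    (hasDerivAt_mul_logBranch hL hs).continuousAt.continuousWithinAt

lemma vertical_mem_halfPlane {σ : ℝ} (hσ : 0 < σ) (y : ℝ) :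
    (σ : ℂ) + (y : ℂ) * Complex.I ∈ halfPlane := by simpa [halfPlane] using hσ

/-- The factor `e` serves to treat the two halves of a vertical line, `e = 1` and `e = -1`, at
once. -/
lemma hasDerivAt_logGam_vertical (hL : IsHalfPlaneWeight L) {σ : ℝ} (hσ : 0 < σ) (e y : ℝ) :
    HasDerivAt (fun y : ℝ => logGam L ((σ : ℂ) + ((e * y : ℝ) : ℂ) * Complex.I))
      (-(e * (logBranch L ((σ : ℂ) + ((e * y : ℝ) : ℂ) * Complex.I) +
        eps L ((σ : ℂ) + ((e * y : ℝ) : ℂ) * Complex.I)).im)) y := by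
  have h1 : HasDerivAt (fun z : ℂ => (σ : ℂ) + ((e : ℂ) * z) * Complex.I)
      ((e : ℂ) * 1 * Complex.I) (y : ℂ) :=
    (((hasDerivAt_id (y : ℂ)).const_mul (e : ℂ)).mul_const Complex.I).const_add _
  have h2 := hasDerivAt_mul_logBranch hL (vertical_mem_halfPlane hσ (e * y))
  rw [Complex.ofReal_mul] at h2
  have h3 := (h2.comp (y : ℂ) h1).real_of_complex
  simp only [Complex.ofReal_mul, logGam]
  refine h3.congr_deriv ?_
  rw [mul_one, ← mul_assoc, Complex.mul_I_re, Complex.mul_im]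
  simp
  ring

lemma eps_re_eq (hL : IsHalfPlaneWeight L) {r : ℝ} (hr : 0 < r) :
    eps L r = ((eps L r).re : ℂ) := by
  rw [eps_ofReal hL.analytic hL.im_eq_zero hr, Complex.ofReal_re]

lemma pi_div_four_le_abs_arg {s : ℂ} (hs : s ∈ halfPlane) (h : s.re ≤ |s.im|) :
    π / 4 ≤ |s.arg| := by
  by_contra! hlt
  have hn := norm_pos_of_mem_halfPlane hs
  have h1 : cos |s.arg| * ‖s‖ = s.re := by
    rw [cos_abs, mul_comm, Complex.norm_mul_cos_arg]
  have h2 : sin |s.arg| * ‖s‖ = |s.im| := by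
    rw [← abs_sin_eq_sin_abs_of_abs_le_pi (Complex.abs_arg_le_pi s), ← abs_of_pos hn, ← abs_mul,
      mul_comm, Complex.norm_mul_sin_arg]
  have h3 : sin |s.arg| < sin (π / 4) :=
    sin_lt_sin_of_lt_of_le_pi_div_two (by linarith [abs_nonneg s.arg, pi_pos])
      (by linarith [pi_pos]) hlt
  have h4 : cos (π / 4) < cos |s.arg| :=
    cos_lt_cos_of_nonneg_of_le_pi (abs_nonneg _) (by linarith [pi_pos]) hlt
  rw [sin_pi_div_four] at h3
  rw [cos_pi_div_four] at h4
  nlinarith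

/-- The logarithmic derivative of `|γ|` along a vertical ray leaving the real axis is at most a
small constant, and it is negative of order `‖s‖ ^ (-1/2)` beyond the diagonal: the main term
`-|arg s| ε(‖s‖)` of the derivative beats the error in the approximation of `ε(s)` by `ε(‖s‖)` as
soon as `|arg s|` is not small. -/
lemma exists_vertical_deriv_bound (hL : IsHalfPlaneWeight L) :
    ∃ κ M : ℝ, 0 < κ ∧ 0 ≤ M ∧ ∀ η : ℝ, 0 < η → η ≤ 1 / 8 → ∃ R : ℝ, 1 ≤ R ∧
      ∀ e : ℝ, |e| = 1 → ∀ s ∈ halfPlane, 0 ≤ e * s.im → R ≤ ‖s‖ →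
        -(e * (logBranch L s + eps L s).im) ≤ η * M ∧
        (s.re ≤ |s.im| → -(e * (logBranch L s + eps L s).im) ≤ -(κ / √|s.im|)) := by
  obtain ⟨M, hM, hMe⟩ := hL.eps_le
  obtain ⟨κ, hκ, hκe⟩ := hL.le_eps
  refine ⟨κ / 4, M, by positivity, hM, fun η hη hη8 => ?_⟩
  obtain ⟨R₁, hR₁⟩ := eventually_atTop.1 (hMe.and hκe)
  obtain ⟨R₂, hR₂⟩ := hL.eps_sub η hη
  refine ⟨max 1 (max R₁ R₂), le_max_left _ _, fun e he s hs hes hRs => ?_⟩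
  have hRs₁ : R₁ ≤ ‖s‖ := (le_max_left R₁ R₂).trans ((le_max_right _ _).trans hRs)
  have hRs₂ : R₂ ≤ ‖s‖ := (le_max_right R₁ R₂).trans ((le_max_right _ _).trans hRs)
  have hn := norm_pos_of_mem_halfPlane hs
  obtain ⟨hM', hκ'⟩ := hR₁ _ hRs₁
  have h1 := abs_im_logBranch_sub_le hL hR₂ hs hRs₂
  have h2 : |(eps L s).im| ≤ η * (eps L (‖s‖ : ℝ)).re := by
    refine le_trans ?_ (hR₂ s hs hRs₂)
    refine le_trans (le_of_eq ?_) (Complex.abs_im_le_norm _)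
    rw [Complex.sub_im, eps_re_eq hL hn, Complex.ofReal_im, sub_zero]
  set E := (eps L (‖s‖ : ℝ)).re
  have hE : 0 < E := lt_of_lt_of_le (by positivity) hκ'
  have harg : e * s.arg = |s.arg| := by
    rcases (abs_eq zero_le_one).1 he with rfl | rfl
    · rw [one_mul, abs_of_nonneg (Complex.arg_nonneg_iff.2 (by simpa using hes))]
    · rcases eq_or_ne s.im 0 with h0 | h0
      · have : s.arg = 0 := Complex.arg_eq_zero_iff.2 ⟨(show 0 < s.re from hs).le, h0⟩
        simp [this]
      · have h0' : s.im < 0 := lt_of_le_of_ne (by linarith) h0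
        rw [abs_of_neg (Complex.arg_neg_iff.2 h0')]
        ring
  have hkey : -(e * (logBranch L s + eps L s).im) ≤ E * (η - (1 - η) * |s.arg|) := by
    have h3 : -(e * ((logBranch L s).im - s.arg * E)) ≤ η * E * |s.arg| := by
      refine le_trans (neg_le_abs _) ?_
      rwa [abs_mul, he, one_mul]
    have h4 : -(e * (eps L s).im) ≤ η * E := by
      refine le_trans (neg_le_abs _) ?_
      rwa [abs_mul, he, one_mul]
    rw [Complex.add_im]
    nlinarith
  constructor
  · refine hkey.trans ?_
    have : 0 ≤ (1 - η) * |s.arg| := mul_nonneg (by linarith) (abs_nonneg _)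
    nlinarith
  · intro hre
    have harg4 := pi_div_four_le_abs_arg hs hre
    have him : 0 < |s.im| := (show 0 < s.re from hs).trans_le hre
    have h5 : η - (1 - η) * |s.arg| ≤ -(1 / 2) := by nlinarith [pi_gt_d2]
    have h6 : √‖s‖ ≤ 2 * √|s.im| := by
      rw [show (2 : ℝ) = √4 by rw [show (4 : ℝ) = 2 ^ 2 by norm_num]; simp,
        ← sqrt_mul (by norm_num)]
      refine sqrt_le_sqrt ((Complex.norm_le_abs_re_add_abs_im s).trans ?_)
      rw [abs_of_pos (show 0 < s.re from hs)]
      linarith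
    have h7 : κ / (2 * √|s.im|) ≤ E :=
      (div_le_div_of_nonneg_left hκ.le (sqrt_pos.2 hn) h6).trans hκ'
    calc -(e * (logBranch L s + eps L s).im) ≤ E * (η - (1 - η) * |s.arg|) := hkey
      _ ≤ E * (-(1 / 2)) := mul_le_mul_of_nonneg_left h5 hE.le
      _ ≤ κ / (2 * √|s.im|) * (-(1 / 2)) := by nlinarith
      _ = -(κ / 4 / √|s.im|) := by ring

/-- Beyond the diagonal, `|γ|` decays at least like `exp (-2κ √|y|)` along vertical lines. -/
lemma logGam_le_beyond_diagonal (hL : IsHalfPlaneWeight L) {κ R e σ : ℝ}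
    (he : |e| = 1)
    (h : ∀ s ∈ halfPlane, 0 ≤ e * s.im → R ≤ ‖s‖ → s.re ≤ |s.im| →
      -(e * (logBranch L s + eps L s).im) ≤ -(κ / √|s.im|))
    (hσ : 0 < σ) {y₀ y : ℝ} (hy₀ : σ ≤ y₀)
    (hr : ∀ y, y₀ ≤ y → R ≤ ‖(σ : ℂ) + ((e * y : ℝ) : ℂ) * Complex.I‖)
    (hy : y₀ ≤ y) :
    logGam L ((σ : ℂ) + ((e * y : ℝ) : ℂ) * Complex.I) ≤
      logGam L ((σ : ℂ) + ((e * y₀ : ℝ) : ℂ) * Complex.I) + 2 * κ * √y₀ - 2 * κ * √y := by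
  have hy₀' : 0 < y₀ := hσ.trans_le hy₀
  have hd : ∀ x ∈ Ici y₀, HasDerivAt
      (fun y : ℝ => logGam L ((σ : ℂ) + ((e * y : ℝ) : ℂ) * Complex.I) + 2 * κ * √y)
      (-(e * (logBranch L ((σ : ℂ) + ((e * x : ℝ) : ℂ) * Complex.I) +
        eps L ((σ : ℂ) + ((e * x : ℝ) : ℂ) * Complex.I)).im) + 2 * κ * (1 / (2 * √x))) x :=
    fun x hx => (hasDerivAt_logGam_vertical hL hσ e x).add
      ((hasDerivAt_sqrt (hy₀'.trans_le hx).ne').const_mul _)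
  have hee : e * e = 1 := by rw [← abs_mul_abs_self, he, one_mul]
  have hanti := antitoneOn_of_deriv_nonpos (convex_Ici y₀)
    (fun x hx => (hd x hx).continuousAt.continuousWithinAt)
    (fun x hx => (hd x (interior_subset hx)).differentiableAt.differentiableWithinAt)
    (fun x hx => by
      rw [interior_Ici] at hx
      have hx' : y₀ ≤ x := le_of_lt hx
      have hx0 : 0 < x := hy₀'.trans_le hx'
      rw [(hd x hx').deriv]
      have him : ((σ : ℂ) + ((e * x : ℝ) : ℂ) * Complex.I).im = e * x := by simp
      have hre : ((σ : ℂ) + ((e * x : ℝ) : ℂ) * Complex.I).re = σ := by simp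
      have h1 := h _ (vertical_mem_halfPlane hσ (e * x))
        (by rw [him, ← mul_assoc, hee, one_mul]; exact hx0.le) (hr x hx')
        (by rw [him, hre, abs_mul, he, one_mul, abs_of_pos hx0]; exact hy₀.trans hx')
      rw [him, abs_mul, he, one_mul, abs_of_pos hx0] at h1
      have h2 : 2 * κ * (1 / (2 * √x)) = κ / √x := by
        have := (sqrt_pos.2 hx0).ne'
        field_simp
      rw [h2]
      linarith)
  have := hanti self_mem_Ici hy hy
  simp only at this
  linarith

/-- Near the real axis only an upper bound `B` for the logarithmic derivative is available, so `|γ|`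
may grow, but slowly. -/
lemma logGam_le_before_diagonal (hL : IsHalfPlaneWeight L) {B R e σ : ℝ} (he : |e| = 1)
    (h : ∀ s ∈ halfPlane, 0 ≤ e * s.im → R ≤ ‖s‖ → -(e * (logBranch L s + eps L s).im) ≤ B)
    (hσ : 0 < σ) (hRσ : R ≤ σ) {y : ℝ} (hy : 0 ≤ y) :
    logGam L ((σ : ℂ) + ((e * y : ℝ) : ℂ) * Complex.I) ≤ logGam L σ + B * y := by
  have hd : ∀ x : ℝ, HasDerivAt
      (fun y : ℝ => logGam L ((σ : ℂ) + ((e * y : ℝ) : ℂ) * Complex.I) - B * y)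
      (-(e * (logBranch L ((σ : ℂ) + ((e * x : ℝ) : ℂ) * Complex.I) +
        eps L ((σ : ℂ) + ((e * x : ℝ) : ℂ) * Complex.I)).im) - B * 1) x :=
    fun x => (hasDerivAt_logGam_vertical hL hσ e x).sub ((hasDerivAt_id x).const_mul _)
  have hee : e * e = 1 := by rw [← abs_mul_abs_self, he, one_mul]
  have hanti := antitoneOn_of_deriv_nonpos (convex_Ici (0 : ℝ))
    (fun x _ => (hd x).continuousAt.continuousWithinAt)
    (fun x _ => (hd x).differentiableAt.differentiableWithinAt)
    (fun x hx => by
      rw [interior_Ici] at hx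
      have hx0 : 0 < x := hx
      rw [(hd x).deriv]
      have him : ((σ : ℂ) + ((e * x : ℝ) : ℂ) * Complex.I).im = e * x := by simp
      have hre : ((σ : ℂ) + ((e * x : ℝ) : ℂ) * Complex.I).re = σ := by simp
      have h1 := h _ (vertical_mem_halfPlane hσ (e * x))
        (by rw [him, ← mul_assoc, hee, one_mul]; exact hx0.le)
        (hRσ.trans (hre.symm.le.trans (Complex.re_le_norm _)))
      linarith)
  have := hanti self_mem_Ici hy hy
  simp only [mul_zero, Complex.ofReal_zero, zero_mul, add_zero, sub_zero] at this
  linarith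

lemma exists_sign_mul_abs (y : ℝ) : ∃ e : ℝ, |e| = 1 ∧ e * |y| = y := by
  rcases le_total 0 y with h | h
  · exact ⟨1, by simp, by rw [abs_of_nonneg h, one_mul]⟩
  · exact ⟨-1, by simp, by rw [abs_of_nonpos h]; ring⟩

lemma exists_mul_sqrt_le (κ η : ℝ) (hη : 0 < η) : ∃ B : ℝ, ∀ σ : ℝ, 0 ≤ σ → κ * √σ ≤ η * σ + B := by
  refine ⟨κ ^ 2 / (4 * η), fun σ hσ => ?_⟩
  have h := sq_sqrt hσ
  have h2 : 0 ≤ η * (√σ - κ / (2 * η)) ^ 2 := by positivity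
  have h3 : η * (√σ - κ / (2 * η)) ^ 2 = η * √σ ^ 2 - κ * √σ + κ ^ 2 / (4 * η) := by
    field_simp
    ring
  rw [h3, h] at h2
  linarith

/-- On a vertical line, `|γ|` is at most its value on the real axis up to a factor
`exp (η σ)` with `η` arbitrarily small, and it decays like the exponential of a square root. -/
theorem exists_norm_gam_vertical_le (hL : IsHalfPlaneWeight L) {c₀ η : ℝ} (hc₀ : 0 < c₀)
    (hη : 0 < η) : ∃ C κ : ℝ, 0 < C ∧ 0 < κ ∧ ∀ σ : ℝ, c₀ ≤ σ → ∀ y : ℝ,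
      ‖gam L ((σ : ℂ) + (y : ℂ) * Complex.I)‖ ≤
        C * exp (η * σ) * trace L σ ^ σ * exp (-κ * √|y|) := by
  obtain ⟨κ, M, hκ, hM, hbound⟩ := exists_vertical_deriv_bound hL
  set η' := min (1 / 8) (η / (2 * (M + 1)))
  have hη' : 0 < η' := by positivity
  have hη'M : η' * M ≤ η / 2 := by
    calc η' * M ≤ η / (2 * (M + 1)) * M := mul_le_mul_of_nonneg_right (min_le_right _ _) hM
      _ ≤ η / (2 * (M + 1)) * (M + 1) := by gcongr; linarith
      _ = η / 2 := by field_simp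
  obtain ⟨R, hR, hb⟩ := hbound η' hη' (min_le_left _ _)
  obtain ⟨B₁, hB₁⟩ := exists_mul_sqrt_le (2 * κ) (η / 2) (by positivity)
  -- Small abscissas: a compact rectangle together with the decay beyond it.
  have hcompact : IsCompact (Icc c₀ R ×ˢ Icc (-R) R) := isCompact_Icc.prod isCompact_Icc
  obtain ⟨B₂, hB₂⟩ := hcompact.bddAbove_image
    (f := fun p : ℝ × ℝ => logGam L ((p.1 : ℂ) + (p.2 : ℂ) * Complex.I))
    ((continuousOn_logGam hL).comp (by fun_prop) fun p hp =>
      vertical_mem_halfPlane (hc₀.trans_le hp.1.1) _)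
  have hB₂' : ∀ σ y : ℝ, c₀ ≤ σ → σ ≤ R → |y| ≤ R →
      logGam L ((σ : ℂ) + (y : ℂ) * Complex.I) ≤ B₂ := fun σ y h1 h2 h3 =>
    hB₂ ⟨(σ, y), ⟨⟨h1, h2⟩, abs_le.1 h3⟩, rfl⟩
  have hlarge : ∀ σ y : ℝ, 0 < σ → R ≤ σ → logGam L ((σ : ℂ) + (y : ℂ) * Complex.I) ≤
      logGam L σ + η * σ + B₁ - 2 * κ * √|y| := by
    intro σ y hσ hRσ
    obtain ⟨e, he, hey⟩ := exists_sign_mul_abs y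
    have h1 := fun y (hy : 0 ≤ y) => logGam_le_before_diagonal hL (y := y) he
      (fun s hs h0 hRs => (hb e he s hs h0 hRs).1) hσ hRσ hy
    have h2 := hB₁ σ hσ.le
    rcases le_total |y| σ with h | h
    · have h3 := h1 |y| (abs_nonneg y)
      rw [hey] at h3
      have h4 : √|y| ≤ √σ := sqrt_le_sqrt h
      have h5 : η' * M * |y| ≤ η / 2 * σ := mul_le_mul hη'M h (abs_nonneg y) (by positivity)
      nlinarith
    · have h3 := logGam_le_beyond_diagonal hL he
        (fun s hs h0 hRs hre => (hb e he s hs h0 hRs).2 hre) hσ le_rfl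
        (fun y _ => hRσ.trans (le_trans (by simp) (Complex.re_le_norm _))) h
      rw [hey] at h3
      have h4 := h1 σ hσ.le
      have h5 : η' * M * σ ≤ η / 2 * σ := mul_le_mul_of_nonneg_right hη'M hσ.le
      linarith
  have hsmall : ∀ σ y : ℝ, c₀ ≤ σ → σ ≤ R → logGam L ((σ : ℂ) + (y : ℂ) * Complex.I) ≤
      B₂ + 2 * κ * √R - 2 * κ * √|y| := by
    intro σ y hσ hσR
    rcases le_total |y| R with h | h
    · have h3 := hB₂' σ y hσ hσR h
      have h4 : √|y| ≤ √R := sqrt_le_sqrt h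
      nlinarith
    · obtain ⟨e, he, hey⟩ := exists_sign_mul_abs y
      have h3 := logGam_le_beyond_diagonal hL he
        (fun s hs h0 hRs hre => (hb e he s hs h0 hRs).2 hre) (hc₀.trans_le hσ) hσR
        (fun y hy => hy.trans (by
          refine le_trans ?_ (Complex.abs_im_le_norm _)
          simp [abs_mul, he, le_abs_self])) h
      rw [hey] at h3
      have h4 := hB₂' σ (e * R) hσ hσR (by rw [abs_mul, he, one_mul, abs_of_nonneg (by linarith)])
      linarith
  refine ⟨exp (max B₁ (B₂ + 2 * κ * √R)), 2 * κ, exp_pos _, by positivity, fun σ hσ y => ?_⟩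
  have hσ0 : 0 < σ := hc₀.trans_le hσ
  rw [norm_gam, rpow_def_of_pos (hL.trace_pos hσ0), ← exp_add, ← exp_add, ← exp_add]
  refine exp_le_exp.2 ?_
  rw [mul_comm (Real.log _)]
  have hlog : 0 ≤ σ * Real.log (trace L σ) :=
    mul_nonneg hσ0.le (log_nonneg (hL.one_le σ hσ0))
  have hησ : 0 ≤ η * σ := by positivity
  rcases le_total R σ with h | h
  · have h1 := hlarge σ y hσ0 h
    rw [logGam_ofReal L hσ0] at h1
    linarith [le_max_left B₁ (B₂ + 2 * κ * √R)]
  · have h1 := hsmall σ y hσ h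
    linarith [le_max_right B₁ (B₂ + 2 * κ * √R)]

/-! ### The kernel and the shift of its contour -/

lemma integrable_exp_neg_mul_sqrt_abs {κ : ℝ} (hκ : 0 < κ) :
    Integrable fun y : ℝ => exp (-κ * √|y|) := by
  refine Integrable.mono' (integrable_inv_one_add_sq.const_mul (1 + 24 / κ ^ 4))
    (by fun_prop) (Eventually.of_forall fun y => ?_)
  rw [norm_of_nonneg (exp_pos _).le, neg_mul, exp_neg, ← div_eq_mul_inv, inv_eq_one_div,
    div_le_div_iff₀ (exp_pos _) (by positivity), one_mul]
  have h1 := pow_div_factorial_le_exp (κ * √|y|) (by positivity) 4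
  have h2 : (κ * √|y|) ^ 4 = κ ^ 4 * y ^ 2 := by
    rw [mul_pow, show (4 : ℕ) = 2 * 2 by norm_num, pow_mul √|y|, sq_sqrt (abs_nonneg y), sq_abs]
  have h3 : 1 ≤ exp (κ * √|y|) := one_le_exp (by positivity)
  rw [h2, show ((Nat.factorial 4 : ℕ) : ℝ) = 24 by norm_num [Nat.factorial]] at h1
  have h4 : y ^ 2 ≤ 24 / κ ^ 4 * exp (κ * √|y|) := by
    rw [div_mul_eq_mul_div, le_div_iff₀ (by positivity)]
    linarith
  linarith

lemma continuous_gam_vertical (hL : IsHalfPlaneWeight L) {c : ℝ} (hc : 0 < c) :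
    Continuous fun y : ℝ => gam L ((c : ℂ) + (y : ℂ) * Complex.I) :=
  (differentiableOn_gam hL).continuousOn.comp_continuous (by fun_prop) (vertical_mem_halfPlane hc)

theorem verticalIntegrable_gam (hL : IsHalfPlaneWeight L) {c : ℝ} (hc : 0 < c) :
    Complex.VerticalIntegrable (gam L) c := by
  obtain ⟨C, κ, hC, hκ, h⟩ := exists_norm_gam_vertical_le hL hc one_pos
  exact Integrable.mono' ((integrable_exp_neg_mul_sqrt_abs hκ).const_mul _)
    (continuous_gam_vertical hL hc).aestronglyMeasurable
    (Eventually.of_forall fun y => h c le_rfl y)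

lemma norm_cpow_mul_gam {t : ℝ} (ht : 0 < t) (σ y : ℝ) :
    ‖(t : ℂ) ^ (-((σ : ℂ) + (y : ℂ) * Complex.I)) * gam L ((σ : ℂ) + (y : ℂ) * Complex.I)‖ =
      t ^ (-σ) * ‖gam L ((σ : ℂ) + (y : ℂ) * Complex.I)‖ := by
  rw [norm_mul, Complex.norm_cpow_eq_rpow_re_of_pos ht]
  simp

lemma differentiableOn_cpow_mul_gam (hL : IsHalfPlaneWeight L) {t : ℝ} (ht : 0 < t) :
    DifferentiableOn ℂ (fun s => (t : ℂ) ^ (-s) * gam L s) halfPlane := by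
  refine DifferentiableOn.mul (fun s _ => ?_) (differentiableOn_gam hL)
  exact (differentiableAt_id.neg.const_cpow
    (Or.inl (by exact_mod_cast ht.ne'))).differentiableWithinAt

lemma integrable_cpow_mul_gam (hL : IsHalfPlaneWeight L) {c t : ℝ} (hc : 0 < c) (ht : 0 < t) :
    Integrable fun y : ℝ => (t : ℂ) ^ (-((c : ℂ) + (y : ℂ) * Complex.I)) *
      gam L ((c : ℂ) + (y : ℂ) * Complex.I) := by
  have hcont : Continuous fun y : ℝ => (t : ℂ) ^ (-((c : ℂ) + (y : ℂ) * Complex.I)) *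
      gam L ((c : ℂ) + (y : ℂ) * Complex.I) :=
    (differentiableOn_cpow_mul_gam hL ht).continuousOn.comp_continuous (by fun_prop)
      (vertical_mem_halfPlane hc)
  refine Integrable.mono' ((verticalIntegrable_gam hL hc).norm.const_mul (t ^ (-c)))
    hcont.aestronglyMeasurable (Eventually.of_forall fun y => (norm_cpow_mul_gam ht c y).le)

lemma continuousOn_trace (hL : IsHalfPlaneWeight L) : ContinuousOn (trace L) (Ioi 0) :=
  fun _ hr => (hasDerivAt_trace hL.analytic hr).continuousAt.continuousWithinAt

/-- By Cauchy's theorem the kernel does not depend on the line of integration. -/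
theorem kernel_eq_kernel (hL : IsHalfPlaneWeight L) {c c' t : ℝ} (hc : 0 < c) (hc' : 0 < c')
    (ht : 0 < t) : kernel L c t = kernel L c' t := by
  set f : ℂ → ℂ := fun s => (t : ℂ) ^ (-s) * gam L s with hf
  obtain ⟨C, κ, hC, hκ, h⟩ := exists_norm_gam_vertical_le hL (lt_min hc hc') one_pos
  have hpos : ∀ σ ∈ uIcc c c', 0 < σ := fun σ hσ => (lt_min hc hc').trans_le hσ.1
  -- A bound for the horizontal sides.
  obtain ⟨B, hB⟩ := (isCompact_uIcc (a := c) (b := c')).bddAbove_image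
    (f := fun σ : ℝ => t ^ (-σ) * (C * exp (1 * σ) * trace L σ ^ σ)) (by
      refine ContinuousOn.mul ?_ (ContinuousOn.mul (by fun_prop) ?_)
      · exact ContinuousOn.rpow continuousOn_const (by fun_prop) fun _ _ => Or.inl ht.ne'
      · exact ContinuousOn.rpow ((continuousOn_trace hL).mono hpos) continuousOn_id fun σ hσ =>
          Or.inl (hL.trace_pos (hpos σ hσ)).ne')
  have hhor : ∀ σ ∈ uIcc c c', ∀ y : ℝ,
      ‖f ((σ : ℂ) + (y : ℂ) * Complex.I)‖ ≤ B * exp (-κ * √|y|) := by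
    intro σ hσ y
    rw [hf]
    simp only
    rw [norm_cpow_mul_gam ht]
    calc t ^ (-σ) * ‖gam L ((σ : ℂ) + (y : ℂ) * Complex.I)‖
        ≤ t ^ (-σ) * (C * exp (1 * σ) * trace L σ ^ σ * exp (-κ * √|y|)) :=
          mul_le_mul_of_nonneg_left (h σ hσ.1 y) (rpow_nonneg ht.le _)
      _ = t ^ (-σ) * (C * exp (1 * σ) * trace L σ ^ σ) * exp (-κ * √|y|) := by ring
      _ ≤ B * exp (-κ * √|y|) :=
          mul_le_mul_of_nonneg_right (hB ⟨σ, hσ, rfl⟩) (exp_pos _).le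
  have hsqrt : Tendsto (fun T : ℝ => B * exp (-κ * √|T|)) atTop (𝓝 0) := by
    rw [← mul_zero B]
    refine (tendsto_exp_atBot.comp ?_).const_mul B
    exact (tendsto_sqrt_atTop.comp tendsto_abs_atTop_atTop).const_mul_atTop_of_neg
      (neg_neg_of_pos hκ)
  have hhor_tendsto : ∀ e : ℝ, |e| = 1 → Tendsto
      (fun T : ℝ => ∫ x : ℝ in c..c', f ((x : ℂ) + ((e * T : ℝ) : ℂ) * Complex.I))
      atTop (𝓝 0) := by
    intro e he
    refine squeeze_zero_norm (a := fun T : ℝ => B * exp (-κ * √|T|) * |c' - c|) (fun T => ?_) ?_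
    · refine intervalIntegral.norm_integral_le_of_norm_le_const fun x hx => ?_
      have := hhor x (uIoc_subset_uIcc hx) (e * T)
      rwa [abs_mul, he, one_mul] at this
    · simpa using hsqrt.mul_const |c' - c|
  have hvert : ∀ σ : ℝ, 0 < σ → Tendsto
      (fun T : ℝ => ∫ y : ℝ in (-T)..T, f ((σ : ℂ) + (y : ℂ) * Complex.I)) atTop
      (𝓝 (∫ y : ℝ, f ((σ : ℂ) + (y : ℂ) * Complex.I))) := fun σ hσ =>
    intervalIntegral_tendsto_integral (integrable_cpow_mul_gam hL hσ ht) tendsto_neg_atTop_atBot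
      tendsto_id
  have hrect : ∀ T : ℝ,
      (∫ x : ℝ in c..c', f ((x : ℂ) + ((-1 * T : ℝ) : ℂ) * Complex.I)) -
        (∫ x : ℝ in c..c', f ((x : ℂ) + ((1 * T : ℝ) : ℂ) * Complex.I)) +
        Complex.I • (∫ y : ℝ in (-T)..T, f ((c' : ℂ) + (y : ℂ) * Complex.I)) -
        Complex.I • (∫ y : ℝ in (-T)..T, f ((c : ℂ) + (y : ℂ) * Complex.I)) = 0 := by
    intro T
    have := Complex.integral_boundary_rect_eq_zero_of_differentiableOn f (⟨c, -T⟩ : ℂ) (⟨c', T⟩ : ℂ)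
      ((differentiableOn_cpow_mul_gam hL ht).mono fun s hs => hpos s.re hs.1)
    simpa using this
  have hlim := (((hhor_tendsto (-1) (by simp)).sub (hhor_tendsto 1 (by simp))).add
    ((hvert c' hc').const_smul Complex.I)).sub ((hvert c hc).const_smul Complex.I)
  have h0 := tendsto_nhds_unique (hlim.congr hrect) tendsto_const_nhds
  rw [sub_zero, zero_add, ← smul_sub, smul_eq_zero] at h0
  have h1 := sub_eq_zero.1 (h0.resolve_left Complex.I_ne_zero)
  simp only [kernel, mellinInv, smul_eq_mul]
  exact congrArg _ h1.symm

/-- Upper bounds for the kernel: move the line of integration to an abscissa `σ` of our choice. -/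
theorem exists_norm_kernel_le (hL : IsHalfPlaneWeight L) {c c₀ η : ℝ} (hc : 0 < c) (hc₀ : 0 < c₀)
    (hη : 0 < η) : ∃ C : ℝ, 0 < C ∧ ∀ σ : ℝ, c₀ ≤ σ → ∀ t : ℝ, 0 < t →
      ‖kernel L c t‖ ≤ C * exp (η * σ) * trace L σ ^ σ * t ^ (-σ) := by
  obtain ⟨C, κ, hC, hκ, h⟩ := exists_norm_gam_vertical_le hL hc₀ hη
  set J := ∫ y : ℝ, exp (-κ * √|y|)
  have hJ : 0 ≤ J := integral_nonneg fun y => (exp_pos _).le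
  refine ⟨C * (J + 1), by positivity, fun σ hσ t ht => ?_⟩
  have hσ0 := hc₀.trans_le hσ
  have htr := hL.trace_pos hσ0
  rw [kernel_eq_kernel hL hc hσ0 ht, kernel, mellinInv, norm_smul]
  have h1 : ‖∫ y : ℝ, (t : ℂ) ^ (-((σ : ℂ) + (y : ℂ) * Complex.I)) •
      gam L ((σ : ℂ) + (y : ℂ) * Complex.I)‖ ≤
      ∫ y : ℝ, t ^ (-σ) * (C * exp (η * σ) * trace L σ ^ σ) * exp (-κ * √|y|) := by
    refine norm_integral_le_of_norm_le ((integrable_exp_neg_mul_sqrt_abs hκ).const_mul _)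
      (Eventually.of_forall fun y => ?_)
    rw [smul_eq_mul, norm_cpow_mul_gam ht, mul_assoc]
    exact mul_le_mul_of_nonneg_left (h σ hσ y) (rpow_nonneg ht.le _)
  rw [integral_const_mul] at h1
  have h2 : ‖(1 / (2 * π) : ℝ)‖ ≤ 1 := by
    rw [norm_of_nonneg (by positivity), div_le_one (by positivity)]
    linarith [pi_gt_three]
  calc ‖(1 / (2 * π) : ℝ)‖ * ‖∫ y : ℝ, (t : ℂ) ^ (-((σ : ℂ) + (y : ℂ) * Complex.I)) •
        gam L ((σ : ℂ) + (y : ℂ) * Complex.I)‖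
      ≤ 1 * (t ^ (-σ) * (C * exp (η * σ) * trace L σ ^ σ) * J) :=
        mul_le_mul h2 h1 (norm_nonneg _) one_pos.le
    _ ≤ 1 * (t ^ (-σ) * (C * exp (η * σ) * trace L σ ^ σ) * (J + 1)) := by
        gcongr
        linarith
    _ = C * (J + 1) * exp (η * σ) * trace L σ ^ σ * t ^ (-σ) := by ring

lemma aestronglyMeasurable_kernel (hL : IsHalfPlaneWeight L) {c : ℝ} (hc : 0 < c)
    (μ : Measure ℝ) : AEStronglyMeasurable (kernel L c) μ := by
  have h1 : Measurable fun y : ℝ => gam L ((c : ℂ) + (y : ℂ) * Complex.I) :=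
    (continuous_gam_vertical hL hc).measurable
  have h2 : Measurable (Function.uncurry fun t y : ℝ =>
      (t : ℂ) ^ (-((c : ℂ) + (y : ℂ) * Complex.I)) •
        gam L ((c : ℂ) + (y : ℂ) * Complex.I)) := by
    have h3 : Measurable fun p : ℝ × ℝ =>
        (p.1 : ℂ) ^ (-((c : ℂ) + (p.2 : ℂ) * Complex.I)) := by fun_prop
    exact h3.smul (h1.comp measurable_snd)
  exact (h2.stronglyMeasurable.integral_prod_right.const_smul _).aestronglyMeasurable

/-! ### Growth of a weight and the product of `E` and the kernel -/

/-- A weight grows at most polynomially, with multiplicative constant one far out. -/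
lemma exists_log_trace_le (hL : IsHalfPlaneWeight L) : ∃ M B R : ℝ, 0 ≤ M ∧ 0 ≤ B ∧ 1 ≤ R ∧
    ∀ r r' : ℝ, 1 ≤ r → r ≤ r' → Real.log (trace L r') ≤
      Real.log (trace L r) + M * Real.log (r' / r) + if r < R then B else 0 := by
  obtain ⟨M, hM, hMe⟩ := hL.eps_le
  obtain ⟨R₁, hR₁⟩ := eventually_atTop.1 hMe
  set R := max 1 R₁
  have hR : 1 ≤ R := le_max_left _ _
  have hd : ∀ x ∈ Ici R, HasDerivAt (fun r => Real.log (trace L r) - M * Real.log r)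
      ((deriv L x).re / trace L x - M * x⁻¹) x := fun x hx => by
    have hx0 : 0 < x := one_pos.trans_le (hR.trans hx)
    exact ((hasDerivAt_trace hL.analytic hx0).log (hL.trace_pos hx0).ne').sub
      ((hasDerivAt_log hx0.ne').const_mul M)
  have hanti := antitoneOn_of_deriv_nonpos (convex_Ici R)
    (fun x hx => (hd x hx).continuousAt.continuousWithinAt)
    (fun x hx => (hd x (interior_subset hx)).differentiableAt.differentiableWithinAt)
    (fun x hx => by
      have hx' := interior_subset hx
      have hx0 : 0 < x := one_pos.trans_le (hR.trans hx')
      rw [(hd x hx').deriv]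
      have h1 := hR₁ x ((le_max_right _ _).trans hx')
      rw [eps_ofReal hL.analytic hL.im_eq_zero hx0, Complex.ofReal_re, mul_div_assoc] at h1
      rw [sub_nonpos, ← div_eq_mul_inv, le_div_iff₀ hx0]
      linarith)
  have hfar : ∀ r r' : ℝ, R ≤ r → r ≤ r' →
      Real.log (trace L r') ≤ Real.log (trace L r) + M * Real.log (r' / r) := by
    intro r r' hr hrr'
    have hr0 : 0 < r := one_pos.trans_le (hR.trans hr)
    have := hanti (show r ∈ Ici R from hr) (show r' ∈ Ici R from hr.trans hrr') hrr'
    simp only at this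
    rw [log_div (hr0.trans_le hrr').ne' hr0.ne', mul_sub]
    linarith
  obtain ⟨B, hB⟩ := (isCompact_Icc (a := (1 : ℝ)) (b := R)).bddAbove_image
    (f := fun r => Real.log (trace L r)) (ContinuousOn.log
      ((continuousOn_trace hL).mono fun r hr => one_pos.trans_le hr.1)
      fun r hr => (hL.trace_pos (one_pos.trans_le hr.1)).ne')
  have hB' : ∀ r, 1 ≤ r → r ≤ R → Real.log (trace L r) ≤ B := fun r h1 h2 => hB ⟨r, ⟨h1, h2⟩, rfl⟩
  have hB0 : 0 ≤ B := (log_nonneg (hL.one_le 1 one_pos)).trans (hB' 1 le_rfl hR)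
  refine ⟨M, B, R, hM, hB0, hR, fun r r' hr hrr' => ?_⟩
  have hr0 : 0 < r := one_pos.trans_le hr
  split_ifs with h
  · have h1 : 0 ≤ Real.log (trace L r) := log_nonneg (hL.one_le r hr0)
    rcases le_total r' R with h' | h'
    · have h2 := hB' r' (hr.trans hrr') h'
      have h3 : 0 ≤ M * Real.log (r' / r) :=
        mul_nonneg hM (log_nonneg ((one_le_div hr0).2 hrr'))
      linarith
    · have h2 := hfar R r' le_rfl h'
      have h3 := hB' R hR le_rfl
      have h4 : M * Real.log (r' / R) ≤ M * Real.log (r' / r) := by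
        have hR0 : 0 < R := one_pos.trans_le hR
        have hr'0 : 0 < r' := hr0.trans_le hrr'
        gcongr
      linarith
  · rw [add_zero]
    exact hfar r r' (not_lt.1 h) hrr'

lemma mul_log_div_le_sub {r r' : ℝ} (hr : 0 < r) (hr' : 0 < r') :
    r * Real.log (r' / r) ≤ r' - r := by
  have h := log_le_sub_one_of_pos (div_pos hr' hr)
  calc r * Real.log (r' / r) ≤ r * (r' / r - 1) := mul_le_mul_of_nonneg_left h hr.le
    _ = r' - r := by field_simp

lemma log_le_mul_add {x ρ : ℝ} (hx : 0 < x) (hρ : 0 < ρ) : Real.log x ≤ ρ * x - Real.log ρ := by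
  have h := log_le_sub_one_of_pos (mul_pos hρ hx)
  rw [log_mul hρ.ne' hx.ne'] at h
  linarith

/-- The quotient `γ(n + m + 2) / γ(m + 1)` is at most `L(n) ^ n`, up to an exponential factor
in `n` and an exponential factor in `m` of arbitrarily small rate. -/
lemma exists_log_gam_quotient_le (hL : IsHalfPlaneWeight L) {ρ : ℝ} (hρ : 0 < ρ) :
    ∃ a b : ℝ, ∀ n m : ℕ, ((n : ℝ) + m + 2) * Real.log (trace L ((n : ℝ) + m + 2)) ≤
      ((m : ℝ) + 1) * Real.log (trace L ((m : ℝ) + 1)) + n * Real.log (trace L n) +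
        ρ * m + a * n + b := by
  obtain ⟨M, B, R, hM, hB, hR, hlog⟩ := exists_log_trace_le hL
  set μ := ρ / (2 * (M + 1))
  have hμ : 0 < μ := by positivity
  have hμM : 2 * M * μ ≤ ρ := by
    calc 2 * M * μ ≤ 2 * (M + 1) * μ := by gcongr; linarith
      _ = ρ := by simp only [μ]; field_simp
  set W := Real.log (trace L 1)
  refine ⟨M + B + M * (3 * μ - Real.log μ) + M,
    M + B * R + B + M * (3 * μ - Real.log μ) + W + M + B, fun n m => ?_⟩
  have hn : (0 : ℝ) ≤ n := Nat.cast_nonneg n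
  have hm : (0 : ℝ) ≤ m := Nat.cast_nonneg m
  set k : ℝ := max (n : ℝ) 1
  have hk1 : 1 ≤ k := le_max_right _ _
  have hk0 : 0 < k := one_pos.trans_le hk1
  have hkn : k ≤ n + 1 := max_le (by linarith) (by linarith)
  have hnk : (n : ℝ) ≤ k := le_max_left _ _
  set r' : ℝ := (n : ℝ) + m + 2
  have hr' : 0 < r' := by positivity
  set x := Real.log (trace L r')
  have h1 : ((m : ℝ) + 1) * x ≤
      ((m : ℝ) + 1) * Real.log (trace L ((m : ℝ) + 1)) + M * (n + 1) + B * R := by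
    have h := hlog ((m : ℝ) + 1) r' (by linarith) (by simp only [r']; linarith)
    have h2 := mul_log_div_le_sub (r := (m : ℝ) + 1) (r' := r') (by positivity) hr'
    have h3 : ((m : ℝ) + 1) * (if (m : ℝ) + 1 < R then B else 0) ≤ B * R := by
      split_ifs with h'
      · rw [mul_comm]; gcongr
      · rw [mul_zero]; positivity
    calc ((m : ℝ) + 1) * x ≤ ((m : ℝ) + 1) * (Real.log (trace L ((m : ℝ) + 1)) +
          M * Real.log (r' / ((m : ℝ) + 1)) + if (m : ℝ) + 1 < R then B else 0) := by gcongr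
      _ = ((m : ℝ) + 1) * Real.log (trace L ((m : ℝ) + 1)) +
          M * (((m : ℝ) + 1) * Real.log (r' / ((m : ℝ) + 1))) +
          ((m : ℝ) + 1) * (if (m : ℝ) + 1 < R then B else 0) := by ring
      _ ≤ ((m : ℝ) + 1) * Real.log (trace L ((m : ℝ) + 1)) + M * (r' - ((m : ℝ) + 1)) +
          B * R := by gcongr
      _ = _ := by simp only [r']; ring
  have hif : ∀ r : ℝ, (if r < R then B else 0) ≤ B := fun r => by
    split_ifs
    exacts [le_rfl, hB]
  have h2 : x ≤ Real.log (trace L k) + M * Real.log (r' / k) + B :=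
    (hlog k r' hk1 (by simp only [r']; linarith)).trans (by linarith [hif k])
  have h3 : ((n : ℝ) + 1) * Real.log (r' / k) ≤
      2 * μ * m + (3 * μ - Real.log μ) * (n + 1) := by
    have h4 := log_le_mul_add (div_pos hr' hk0) hμ
    have h5 : ((n : ℝ) + 1) * (r' / k) ≤ 2 * m + 3 * (n + 1) := by
      rw [mul_div_assoc', div_le_iff₀ hk0]
      have h6 : r' ≤ 3 * k + m := by simp only [r']; linarith
      nlinarith
    calc ((n : ℝ) + 1) * Real.log (r' / k)
        ≤ ((n : ℝ) + 1) * (μ * (r' / k) - Real.log μ) := by gcongr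
      _ = μ * (((n : ℝ) + 1) * (r' / k)) - Real.log μ * (n + 1) := by ring
      _ ≤ μ * (2 * m + 3 * (n + 1)) - Real.log μ * (n + 1) := by gcongr
      _ = _ := by ring
  have h7 : Real.log (trace L k) ≤ W + M * (n + 1) + B := by
    have h8 := hlog 1 k le_rfl hk1
    rw [div_one] at h8
    have h9 : M * Real.log k ≤ M * (n + 1) := by
      gcongr
      exact (log_le_self hk0.le).trans hkn
    linarith [hif 1]
  have h10 : (n : ℝ) * Real.log (trace L k) = n * Real.log (trace L n) := by
    rcases Nat.eq_zero_or_pos n with h0 | h0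
    · simp [h0]
    · have : k = n := max_eq_left (by exact_mod_cast h0)
      rw [this]
  calc r' * x = ((m : ℝ) + 1) * x + ((n : ℝ) + 1) * x := by simp only [r']; ring
    _ ≤ (((m : ℝ) + 1) * Real.log (trace L ((m : ℝ) + 1)) + M * (n + 1) + B * R) +
        ((n : ℝ) + 1) * (Real.log (trace L k) + M * Real.log (r' / k) + B) := by gcongr
    _ = (((m : ℝ) + 1) * Real.log (trace L ((m : ℝ) + 1)) + M * (n + 1) + B * R) +
        n * Real.log (trace L k) + Real.log (trace L k) +
        M * (((n : ℝ) + 1) * Real.log (r' / k)) + ((n : ℝ) + 1) * B := by ring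
    _ ≤ (((m : ℝ) + 1) * Real.log (trace L ((m : ℝ) + 1)) + M * (n + 1) + B * R) +
        n * Real.log (trace L n) + (W + M * (n + 1) + B) +
        M * (2 * μ * m + (3 * μ - Real.log μ) * (n + 1)) + ((n : ℝ) + 1) * B := by
        rw [h10]; gcongr
    _ = ((m : ℝ) + 1) * Real.log (trace L ((m : ℝ) + 1)) + n * Real.log (trace L n) +
        2 * M * μ * m + (M + B + M * (3 * μ - Real.log μ) + M) * n +
        (M + B * R + B + M * (3 * μ - Real.log μ) + W + M + B) := by ring
    _ ≤ _ := by gcongr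

/-- An integrable majorant on `(0, ∞)`. -/
def majorant (t : ℝ) : ℝ := if t ≤ 1 then t ^ (-(1 / 2) : ℝ) else t ^ (-2 : ℝ)

lemma majorant_nonneg {t : ℝ} (ht : 0 < t) : 0 ≤ majorant t := by
  rw [majorant]
  split_ifs <;> positivity

lemma integrableOn_majorant : IntegrableOn majorant (Ioi 0) := by
  rw [← Ioc_union_Ioi_eq_Ioi (zero_le_one' ℝ)]
  refine IntegrableOn.union ?_ ?_
  · refine IntegrableOn.congr_fun (f := fun t : ℝ => t ^ (-(1 / 2) : ℝ)) ?_
      (fun t ht => by simp [majorant, ht.2]) measurableSet_Ioc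
    exact (intervalIntegrable_iff_integrableOn_Ioc_of_le zero_le_one).1
      (intervalIntegral.intervalIntegrable_rpow' (by norm_num))
  · refine IntegrableOn.congr_fun (f := fun t : ℝ => t ^ (-2 : ℝ))
      (integrableOn_Ioi_rpow_of_lt (by norm_num) one_pos) (fun t ht => ?_) measurableSet_Ioi
    rw [majorant, if_neg (not_le.2 (mem_Ioi.1 ht))]

lemma exists_pow_mul_norm_kernel_le (hL : IsHalfPlaneWeight L) {c η : ℝ} (hc : 0 < c)
    (hη : 0 < η) : ∃ C : ℝ, 0 < C ∧ ∀ N : ℕ, ∀ t : ℝ, 0 < t → t ^ N * ‖kernel L c t‖ ≤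
      C * exp (η * N) * trace L ((N : ℝ) + 2) ^ ((N : ℝ) + 2) * majorant t := by
  obtain ⟨C, hC, h⟩ := exists_norm_kernel_le hL hc one_half_pos hη
  set C' := C * exp (η * (1 / 2)) * trace L (1 / 2) ^ (1 / 2 : ℝ)
  have hC' : 0 < C' := by
    have := hL.trace_pos one_half_pos
    positivity
  refine ⟨C' + C * exp (η * 2), by positivity, fun N t ht => ?_⟩
  have hN : (0 : ℝ) < (N : ℝ) + 2 := by positivity
  have hw : 1 ≤ trace L ((N : ℝ) + 2) ^ ((N : ℝ) + 2) :=
    one_le_rpow (hL.one_le _ hN) hN.le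
  have he : 1 ≤ exp (η * N) := one_le_exp (by positivity)
  rw [majorant]
  split_ifs with ht1
  · have h1 := h (1 / 2) le_rfl t ht
    calc t ^ N * ‖kernel L c t‖ ≤ 1 * (C' * t ^ (-(1 / 2) : ℝ)) :=
          mul_le_mul (pow_le_one₀ ht.le ht1) h1 (norm_nonneg _) one_pos.le
      _ = (C' * 1 * 1) * t ^ (-(1 / 2) : ℝ) := by ring
      _ ≤ ((C' + C * exp (η * 2)) * exp (η * N) * trace L ((N : ℝ) + 2) ^ ((N : ℝ) + 2)) *
          t ^ (-(1 / 2) : ℝ) := by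
          gcongr
          have : 0 < C * exp (η * 2) := by positivity
          linarith
  · have h1 := h ((N : ℝ) + 2) (by linarith [(Nat.cast_nonneg N : (0 : ℝ) ≤ N)]) t ht
    have h2 : t ^ N * t ^ (-((N : ℝ) + 2)) = t ^ (-2 : ℝ) := by
      rw [← rpow_natCast, ← rpow_add ht]
      congr 1
      ring
    calc t ^ N * ‖kernel L c t‖
        ≤ t ^ N * (C * exp (η * ((N : ℝ) + 2)) * trace L ((N : ℝ) + 2) ^ ((N : ℝ) + 2) *
          t ^ (-((N : ℝ) + 2))) := by gcongr
      _ = C * exp (η * ((N : ℝ) + 2)) * trace L ((N : ℝ) + 2) ^ ((N : ℝ) + 2) *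
          (t ^ N * t ^ (-((N : ℝ) + 2))) := by ring
      _ = (C * exp (η * 2)) * exp (η * N) * trace L ((N : ℝ) + 2) ^ ((N : ℝ) + 2) *
          t ^ (-2 : ℝ) := by
          rw [h2, mul_add, exp_add]
          ring
      _ ≤ (C' + C * exp (η * 2)) * exp (η * N) * trace L ((N : ℝ) + 2) ^ ((N : ℝ) + 2) *
          t ^ (-2 : ℝ) := by
          gcongr
          linarith

lemma summable_entireE (hL : IsHalfPlaneWeight L) (x : ℝ) :
    Summable fun n : ℕ => x ^ n / trace L ((n : ℝ) + 1) ^ (n + 1) := by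
  have h1 : ∀ᶠ n : ℕ in atTop, 2 * |x| + 1 ≤ trace L ((n : ℝ) + 1) :=
    (hL.unbounded.comp (tendsto_atTop_add_const_right _ 1 tendsto_natCast_atTop_atTop)).eventually
      (eventually_ge_atTop _)
  refine Summable.of_norm_bounded_eventually_nat
    (summable_geometric_of_lt_one (by norm_num : (0 : ℝ) ≤ 1 / 2) (by norm_num)) ?_
  filter_upwards [h1] with n hn
  have h2 : 1 ≤ trace L ((n : ℝ) + 1) := hL.one_le _ (by positivity)
  have h3 : 0 < trace L ((n : ℝ) + 1) := one_pos.trans_le h2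
  rw [norm_div, norm_pow, norm_pow, norm_eq_abs, norm_of_nonneg h3.le, div_le_iff₀ (by positivity)]
  calc |x| ^ n ≤ (1 / 2 * trace L ((n : ℝ) + 1)) ^ n := by
        gcongr
        linarith
    _ = (1 / 2) ^ n * trace L ((n : ℝ) + 1) ^ n := mul_pow _ _ _
    _ ≤ (1 / 2) ^ n * trace L ((n : ℝ) + 1) ^ (n + 1) := by
        gcongr
        exact n.le_succ

lemma entireE_mono (hL : IsHalfPlaneWeight L) {x y : ℝ} (hx : 0 ≤ x) (hxy : x ≤ y) :
    entireE (trace L) x ≤ entireE (trace L) y := by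
  refine (summable_entireE hL x).tsum_le_tsum (fun n => ?_) (summable_entireE hL y)
  have := hL.trace_pos (r := (n : ℝ) + 1) (by positivity)
  gcongr

lemma entireE_pos (hL : IsHalfPlaneWeight L) {x : ℝ} (hx : 0 ≤ x) :
    0 < entireE (trace L) x := by
  have h : ∀ n : ℕ, 0 < trace L ((n : ℝ) + 1) := fun n => hL.trace_pos (by positivity)
  refine (summable_entireE hL x).tsum_pos (fun n => ?_) 0 ?_
  · have := h n
    positivity
  · have := h 0
    positivity

/-- The product of `E(q t)`, `q < 1`, and the kernel is small: each term of the power series of `E`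
is compared with a bound for the kernel obtained from its own line of integration, which makes the
saddle-point asymptotics of `E` and of the kernel unnecessary. -/
theorem exists_pow_mul_entireE_mul_norm_kernel_le (hL : IsHalfPlaneWeight L) {c q : ℝ}
    (hc : 0 < c) (hq0 : 0 < q) (hq1 : q < 1) : ∃ A C : ℝ, 0 < A ∧ 0 < C ∧ ∀ n : ℕ, ∀ t : ℝ, 0 < t →
      t ^ n * entireE (trace L) (q * t) * ‖kernel L c t‖ ≤
        C * (A * trace L n) ^ n * majorant t := by
  set η := -Real.log q / 4
  have hη : 0 < η := by have := log_neg hq0 hq1; simp only [η]; linarith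
  obtain ⟨C, hC, hK⟩ := exists_pow_mul_norm_kernel_le hL hc hη
  obtain ⟨a, b, hab⟩ := exists_log_gam_quotient_le hL hη
  have hrat : exp (-(2 * η)) < 1 := exp_lt_one_iff.2 (by linarith)
  have hgeom := summable_geometric_of_lt_one (exp_pos _).le hrat
  set S := ∑' m : ℕ, exp (-(2 * η)) ^ m
  have hS : 0 < S := hgeom.tsum_pos (fun m => by positivity) 0 (by simp)
  refine ⟨exp (a + η), C * exp b * S, exp_pos _, by positivity, fun n t ht => ?_⟩
  set D := C * exp b * (exp (a + η) * trace L n) ^ n * majorant t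
  have hterm : ∀ m : ℕ, t ^ n * ((q * t) ^ m / trace L ((m : ℝ) + 1) ^ (m + 1)) * ‖kernel L c t‖ ≤
      D * exp (-(2 * η)) ^ m := by
    intro m
    have hm := hL.trace_pos (r := (m : ℝ) + 1) (by positivity)
    have hnm := hL.trace_pos (r := (n : ℝ) + m + 2) (by positivity)
    have hmaj := majorant_nonneg ht
    have h1 := hK (n + m) t ht
    rw [Nat.cast_add] at h1
    have hpow : trace L n ^ n = exp (n * Real.log (trace L n)) := by
      rcases Nat.eq_zero_or_pos n with h0 | h0
      · simp [h0]
      · rw [exp_nat_mul, exp_log (hL.trace_pos (by exact_mod_cast h0))]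
    have hquot : q ^ m / trace L ((m : ℝ) + 1) ^ (m + 1) *
        (exp (η * ((n : ℝ) + m)) * trace L ((n : ℝ) + m + 2) ^ ((n : ℝ) + m + 2)) ≤
        exp b * (exp (a + η) * trace L n) ^ n * exp (-(2 * η)) ^ m := by
      have e1 : q ^ m = exp (-(4 * η) * m) := by
        rw [mul_comm, exp_nat_mul]
        simp only [η]
        rw [show -(4 * (-Real.log q / 4)) = Real.log q by ring, exp_log hq0]
      have e2 : trace L ((m : ℝ) + 1) ^ (m + 1) =
          exp (((m : ℝ) + 1) * Real.log (trace L ((m : ℝ) + 1))) := by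
        rw [← Nat.cast_succ, exp_nat_mul, exp_log (by simpa using hm)]
      rw [mul_pow, hpow, ← exp_nat_mul, ← exp_nat_mul, e1, e2, ← exp_sub, rpow_def_of_pos hnm,
        ← exp_add, ← exp_add, ← exp_add, ← exp_add, ← exp_add]
      refine exp_le_exp.2 ?_
      have := hab n m
      linarith
    calc t ^ n * ((q * t) ^ m / trace L ((m : ℝ) + 1) ^ (m + 1)) * ‖kernel L c t‖
        = q ^ m / trace L ((m : ℝ) + 1) ^ (m + 1) * (t ^ (n + m) * ‖kernel L c t‖) := by
          rw [mul_pow, pow_add]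
          ring
      _ ≤ q ^ m / trace L ((m : ℝ) + 1) ^ (m + 1) * (C * exp (η * ((n : ℝ) + m)) *
          trace L ((n : ℝ) + m + 2) ^ ((n : ℝ) + m + 2) * majorant t) := by gcongr
      _ = C * majorant t * (q ^ m / trace L ((m : ℝ) + 1) ^ (m + 1) * (exp (η * ((n : ℝ) + m)) *
          trace L ((n : ℝ) + m + 2) ^ ((n : ℝ) + m + 2))) := by ring
      _ ≤ C * majorant t * (exp b * (exp (a + η) * trace L n) ^ n * exp (-(2 * η)) ^ m) := by
          gcongr
      _ = D * exp (-(2 * η)) ^ m := by simp only [D]; ring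
  calc t ^ n * entireE (trace L) (q * t) * ‖kernel L c t‖
      = ∑' m : ℕ, t ^ n * ((q * t) ^ m / trace L ((m : ℝ) + 1) ^ (m + 1)) * ‖kernel L c t‖ := by
        rw [entireE, ← tsum_mul_left, ← tsum_mul_right]
    _ ≤ ∑' m : ℕ, D * exp (-(2 * η)) ^ m :=
        (((summable_entireE hL (q * t)).mul_left _).mul_right _).tsum_le_tsum hterm
          (hgeom.mul_left D)
    _ = C * exp b * S * (exp (a + η) * trace L n) ^ n * majorant t := by
        rw [tsum_mul_left]
        simp only [D, S]
        ring

/-! ### Intervals around the origin -/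

lemma exists_lt_mem_of_isOpen {I : Set ℝ} (hI : IsOpen (I ∩ Ioi 0)) {b : ℝ} (hb : b ∈ I)
    (hb0 : 0 < b) : ∃ c ∈ I, b < c := by
  obtain ⟨c, hbc, hc⟩ := ((eventually_mem_nhdsWithin (s := Ioi b)).and
    (mem_nhdsWithin_of_mem_nhds (hI.mem_nhds ⟨hb, hb0⟩))).exists
  exact ⟨c, hc.1, hbc⟩

lemma exists_upper_barrier {I : Set ℝ} (hI : IsOpen (I ∩ Ioi 0)) (h0 : (0 : ℝ) ∈ I) {x : ℝ}
    (hx : x ∈ I) : ∃ b ∈ I, 0 ≤ b ∧ x ≤ b ∧ ∀ᶠ y in 𝓝[I] x, y ≤ b := by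
  by_cases h : ∃ b ∈ I, 0 < b ∧ x < b
  · obtain ⟨b, hb, hb0, hxb⟩ := h
    exact ⟨b, hb, hb0.le, hxb.le, mem_nhdsWithin_of_mem_nhds (Iic_mem_nhds hxb)⟩
  · push Not at h
    have hx0 : x ≤ 0 := by
      by_contra! hx0
      obtain ⟨c, hc, hxc⟩ := exists_lt_mem_of_isOpen hI hx hx0
      exact (h c hc (hx0.trans hxc)).not_gt hxc
    refine ⟨0, h0, le_rfl, hx0, ?_⟩
    filter_upwards [self_mem_nhdsWithin] with y hy
    by_contra! hy0
    exact ((h y hy hy0).trans hx0).not_gt hy0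

lemma isOpen_neg_preimage_inter {I : Set ℝ} (hI : IsOpen (I ∩ Iio 0)) :
    IsOpen (Neg.neg ⁻¹' I ∩ Ioi 0) := by
  have : Neg.neg ⁻¹' I ∩ Ioi (0 : ℝ) = Neg.neg ⁻¹' (I ∩ Iio 0) := by
    ext x
    simp
  rw [this]
  exact hI.preimage continuous_neg

lemma exists_Icc_mem_nhdsWithin {I : Set ℝ} (hI : I.OrdConnected) (h0 : (0 : ℝ) ∈ I)
    (hpos : IsOpen (I ∩ Ioi 0)) (hneg : IsOpen (I ∩ Iio 0)) {x : ℝ} (hx : x ∈ I) :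
    ∃ a b : ℝ, a ≤ 0 ∧ 0 ≤ b ∧ Icc a b ⊆ I ∧ x ∈ Icc a b ∧ Icc a b ∈ 𝓝[I] x := by
  obtain ⟨b, hb, hb0, hxb, hbn⟩ := exists_upper_barrier hpos h0 hx
  obtain ⟨a, ha, ha0, hxa, han⟩ := exists_upper_barrier (isOpen_neg_preimage_inter hneg)
    (by simpa using h0) (show -x ∈ Neg.neg ⁻¹' I by simpa using hx)
  have ha' : ∀ᶠ y in 𝓝[I] x, -y ≤ a := by
    have : Tendsto (fun y : ℝ => -y) (𝓝[I] x) (𝓝[Neg.neg ⁻¹' I] (-x)) :=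
      tendsto_nhdsWithin_iff.2 ⟨(continuous_neg.tendsto x).mono_left nhdsWithin_le_nhds,
        by filter_upwards [self_mem_nhdsWithin] with y hy; simpa using hy⟩
    exact this.eventually han
  refine ⟨-a, b, by linarith, hb0, hI.out ha hb, ⟨by linarith, hxb⟩, ?_⟩
  filter_upwards [ha', hbn] with y h1 h2
  exact ⟨by linarith, h2⟩

/-! ### Bounds for the functions of the class and for their derivatives -/

lemma exists_norm_le_of_re_le {G : ℂ → ℂ} (hG : Continuous G) (U Y : ℝ) :
    ∃ B : ℝ, 0 < B ∧ ∀ z : ℂ, -Y ≤ z.re → z.re ≤ U → |z.im| ≤ Y → ‖G z‖ ≤ B := by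
  obtain ⟨B, hB⟩ := (isCompact_Icc (a := -Y) (b := U)).reProdIm (isCompact_Icc (a := -Y) (b := Y))
    |>.exists_bound_of_continuousOn hG.continuousOn
  exact ⟨max B 1, by positivity, fun z h1 h2 h3 =>
    (hB z ⟨⟨h1, h2⟩, abs_le.1 h3⟩).trans (le_max_left _ _)⟩

/-- The bound imposed by a point `c` of the interval controls the function near `x t`, for all
`x` in a compact interval to the left of `q c`, by `E(q t)`: the width `Y` is absorbed by `q`. -/
lemma exists_norm_le_entireE_right (hL : IsHalfPlaneWeight L) {G : ℂ → ℂ} (hG : Continuous G)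
    {b c q Y : ℝ} (hb : 0 ≤ b) (hc : 0 < c) (hq : 0 < q) (hbc : b < q * c) (hY : 0 < Y)
    (h : ∃ C : ℝ, ∀ᶠ u : ℝ in atTop, ∀ v : ℝ, |v| ≤ Y →
      ‖G ((u : ℂ) + v * Complex.I)‖ ≤ C * entireE (trace L) (u / c)) :
    ∃ C : ℝ, 0 < C ∧ ∀ x ∈ Icc 0 b, ∀ t : ℝ, 0 < t → ∀ z : ℂ,
      ‖z - ((x * t : ℝ) : ℂ)‖ ≤ Y → ‖G z‖ ≤ C * entireE (trace L) (q * t) := by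
  obtain ⟨C, hC⟩ := h
  obtain ⟨U, hU⟩ := eventually_atTop.1 hC
  obtain ⟨B, hB, hGB⟩ := exists_norm_le_of_re_le hG (max U 0) Y
  set T := Y / (q * c - b)
  have hqc : 0 < q * c - b := by linarith
  have hT : 0 < T := by positivity
  set e₀ := entireE (trace L) 0
  have he₀ : 0 < e₀ := entireE_pos hL le_rfl
  set e₁ := entireE (trace L) ((b * T + Y) / c)
  have he₁ : 0 < e₁ := entireE_pos hL (by positivity)
  refine ⟨B / e₀ + |C| + |C| * e₁ / e₀, by positivity, fun x hx t ht z hz => ?_⟩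
  have he : e₀ ≤ entireE (trace L) (q * t) := entireE_mono hL le_rfl (by positivity)
  have hepos : 0 < entireE (trace L) (q * t) := he₀.trans_le he
  have hre : |z.re - x * t| ≤ Y := by
    have := (Complex.abs_re_le_norm _).trans hz
    rwa [Complex.sub_re, Complex.ofReal_re] at this
  have him : |z.im| ≤ Y := by
    have := (Complex.abs_im_le_norm _).trans hz
    rwa [Complex.sub_im, Complex.ofReal_im, sub_zero] at this
  have hxt : 0 ≤ x * t := mul_nonneg hx.1 ht.le
  have hxt' : x * t ≤ b * t := mul_le_mul_of_nonneg_right hx.2 ht.le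
  obtain ⟨hre1, hre2⟩ := abs_le.1 hre
  have hsplit : (B / e₀ + |C| + |C| * e₁ / e₀) * entireE (trace L) (q * t) =
      B / e₀ * entireE (trace L) (q * t) + |C| * entireE (trace L) (q * t) +
        |C| * e₁ / e₀ * entireE (trace L) (q * t) := by ring
  have hp1 : 0 ≤ B / e₀ * entireE (trace L) (q * t) := by positivity
  have hp2 : 0 ≤ |C| * entireE (trace L) (q * t) := by positivity
  have hp3 : 0 ≤ |C| * e₁ / e₀ * entireE (trace L) (q * t) := by positivity
  rw [hsplit]
  rcases le_total z.re (max U 0) with hzU | hzU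
  · have h1 : B ≤ B / e₀ * entireE (trace L) (q * t) := by
      calc B = B / e₀ * e₀ := by field_simp
        _ ≤ _ := by gcongr
    linarith [hGB z (by linarith) hzU him]
  · have hz0 : 0 ≤ z.re := (le_max_right _ _).trans hzU
    have h1 := hU z.re ((le_max_left _ _).trans hzU) z.im him
    rw [Complex.re_add_im] at h1
    have h2 : ‖G z‖ ≤ |C| * entireE (trace L) (z.re / c) :=
      h1.trans (mul_le_mul_of_nonneg_right (le_abs_self C) (entireE_pos hL (by positivity)).le)
    rcases le_total T t with hTt | hTt
    · have h3 : z.re / c ≤ q * t := by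
        rw [div_le_iff₀ hc]
        have := (div_le_iff₀ hqc).1 hTt
        linarith
      have h4 := mul_le_mul_of_nonneg_left (entireE_mono hL (by positivity) h3) (abs_nonneg C)
      linarith
    · have h3 : z.re / c ≤ (b * T + Y) / c := by
        have : b * t ≤ b * T := mul_le_mul_of_nonneg_left hTt hb
        gcongr
        linarith
      have h4 : |C| * entireE (trace L) (z.re / c) ≤ |C| * e₁ :=
        mul_le_mul_of_nonneg_left (entireE_mono hL (by positivity) h3) (abs_nonneg C)
      have h5 : |C| * e₁ ≤ |C| * e₁ / e₀ * entireE (trace L) (q * t) := by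
        calc |C| * e₁ = |C| * e₁ / e₀ * e₀ := by field_simp
          _ ≤ _ := by gcongr
      linarith

/-- If the right end of the interval is positive, some `q < 1` leaves room for a larger point of
the interval; if it is `0`, only a disc around the origin matters. -/
lemma exists_lt_one_norm_le_entireE_right (hL : IsHalfPlaneWeight L) {I : Set ℝ}
    (hI : IsOpen (I ∩ Ioi 0)) {G : ℂ → ℂ} (hG : Continuous G)
    (h : ∀ Y : ℝ, 0 < Y → ∀ c ∈ I, 0 < c → ∃ C : ℝ, ∀ᶠ u : ℝ in atTop, ∀ v : ℝ, |v| ≤ Y →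
      ‖G ((u : ℂ) + v * Complex.I)‖ ≤ C * entireE (trace L) (u / c))
    {b : ℝ} (hb : b ∈ I) (hb0 : 0 ≤ b) :
    ∃ q : ℝ, 0 < q ∧ q < 1 ∧ ∀ Y : ℝ, 0 < Y → ∃ C : ℝ, 0 < C ∧ ∀ x ∈ Icc 0 b, ∀ t : ℝ, 0 < t →
      ∀ z : ℂ, ‖z - ((x * t : ℝ) : ℂ)‖ ≤ Y → ‖G z‖ ≤ C * entireE (trace L) (q * t) := by
  rcases hb0.eq_or_lt with rfl | hb0'
  · refine ⟨1 / 2, by norm_num, by norm_num, fun Y hY => ?_⟩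
    obtain ⟨B, hB, hGB⟩ := exists_norm_le_of_re_le hG Y Y
    have he₀ := entireE_pos hL le_rfl
    refine ⟨B / entireE (trace L) 0, by positivity, fun x hx t ht z hz => ?_⟩
    have hx0 : x = 0 := le_antisymm hx.2 hx.1
    rw [hx0, zero_mul, Complex.ofReal_zero, sub_zero] at hz
    have h1 := abs_le.1 ((Complex.abs_re_le_norm z).trans hz)
    calc ‖G z‖ ≤ B := hGB z h1.1 h1.2 ((Complex.abs_im_le_norm z).trans hz)
      _ = B / entireE (trace L) 0 * entireE (trace L) 0 := by field_simp
      _ ≤ _ := by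
          gcongr
          exact entireE_mono hL le_rfl (by positivity)
  · obtain ⟨c, hc, hbc⟩ := exists_lt_mem_of_isOpen hI hb hb0'
    have hc0 : 0 < c := hb0'.trans hbc
    obtain ⟨q, hq1, hq2⟩ := exists_between ((div_lt_one hc0).2 hbc)
    have hq0 : 0 < q := (div_pos hb0' hc0).trans hq1
    exact ⟨q, hq0, hq2, fun Y hY => exists_norm_le_entireE_right hL hG hb0 hc0 hq0
      ((div_lt_iff₀ hc0).1 hq1) hY (h Y hY c hc hc0)⟩

theorem exists_lt_one_norm_le_entireE (hL : IsHalfPlaneWeight L) {I : Set ℝ}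
    (hpos : IsOpen (I ∩ Ioi 0)) (hneg : IsOpen (I ∩ Iio 0)) {F : ℂ → ℂ}
    (hF : F ∈ classA (trace L) I) {a b : ℝ} (ha : a ∈ I) (hb : b ∈ I) (ha0 : a ≤ 0) (hb0 : 0 ≤ b) :
    ∃ q : ℝ, 0 < q ∧ q < 1 ∧ ∀ Y : ℝ, 0 < Y → ∃ C : ℝ, 0 < C ∧ ∀ x ∈ Icc a b, ∀ t : ℝ, 0 < t →
      ∀ z : ℂ, ‖z - ((x * t : ℝ) : ℂ)‖ ≤ Y → ‖F z‖ ≤ C * entireE (trace L) (q * t) := by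
  have hFc : Continuous F := hF.1.continuous
  obtain ⟨q₁, hq₁0, hq₁1, h₁⟩ := exists_lt_one_norm_le_entireE_right hL hpos hFc
    (fun Y hY => (hF.2 Y hY).1) hb hb0
  obtain ⟨q₂, hq₂0, hq₂1, h₂⟩ := exists_lt_one_norm_le_entireE_right hL
    (isOpen_neg_preimage_inter hneg) (hFc.comp continuous_neg) (fun Y hY c hc hc0 => by
      obtain ⟨C, hC⟩ := (hF.2 Y hY).2 (-c) hc (by linarith)
      refine ⟨C, ?_⟩
      filter_upwards [tendsto_neg_atTop_atBot.eventually hC] with u hu v hv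
      have := hu (-v) (by rwa [abs_neg])
      rw [neg_div_neg_eq] at this
      have harg : -((u : ℂ) + v * Complex.I) = ((-u : ℝ) : ℂ) + ((-v : ℝ) : ℂ) * Complex.I := by
        push_cast
        ring
      rwa [Function.comp_apply, harg]) (b := -a) (by simpa using ha) (by linarith)
  refine ⟨max q₁ q₂, lt_max_of_lt_left hq₁0, max_lt hq₁1 hq₂1, fun Y hY => ?_⟩
  obtain ⟨C₁, hC₁, h₁⟩ := h₁ Y hY
  obtain ⟨C₂, hC₂, h₂⟩ := h₂ Y hY
  refine ⟨max C₁ C₂, lt_max_of_lt_left hC₁, fun x hx t ht z hz => ?_⟩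
  have hmono : ∀ q, 0 < q → q ≤ max q₁ q₂ →
      entireE (trace L) (q * t) ≤ entireE (trace L) (max q₁ q₂ * t) := fun q hq hqm =>
    entireE_mono hL (by positivity) (by gcongr)
  have hE : 0 < entireE (trace L) (max q₁ q₂ * t) := entireE_pos hL (by positivity)
  rcases le_total 0 x with hx0 | hx0
  · calc ‖F z‖ ≤ C₁ * entireE (trace L) (q₁ * t) := h₁ x ⟨hx0, hx.2⟩ t ht z hz
      _ ≤ C₁ * entireE (trace L) (max q₁ q₂ * t) := by
          gcongr
          exact hmono q₁ hq₁0 (le_max_left _ _)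
      _ ≤ _ := by
          gcongr
          exact le_max_left _ _
  · have h3 := h₂ (-x) ⟨by linarith, by linarith [hx.1]⟩ t ht (-z) (by
      rwa [neg_mul, Complex.ofReal_neg, ← neg_sub', norm_neg])
    simp only [Function.comp_apply, neg_neg] at h3
    calc ‖F z‖ ≤ C₂ * entireE (trace L) (q₂ * t) := h3
      _ ≤ C₂ * entireE (trace L) (max q₁ q₂ * t) := by
          gcongr
          exact hmono q₂ hq₂0 (le_max_right _ _)
      _ ≤ _ := by
          gcongr
          exact le_max_right _ _

/-! ### Differentiation under the integral sign -/

/-- Differentiation under the integral sign within a convex set, so that one-sided derivatives at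
the endpoints of an interval are included. -/
lemma hasDerivWithinAt_integral_of_convex {μ : Measure ℝ} {φ φ' : ℝ → ℝ → ℂ} {g : ℝ → ℝ}
    {s : Set ℝ} (hs : Convex ℝ s) {x : ℝ} (hx : x ∈ s) (hint : ∀ y ∈ s, Integrable (φ y) μ)
    (hderiv : ∀ᵐ t ∂μ, ∀ y ∈ s, HasDerivWithinAt (fun y => φ y t) (φ' y t) s y)
    (hbound : ∀ᵐ t ∂μ, ∀ y ∈ s, ‖φ' y t‖ ≤ g t) (hg : Integrable g μ) :
    HasDerivWithinAt (fun y => ∫ t, φ y t ∂μ) (∫ t, φ' x t ∂μ) s x := by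
  rw [hasDerivWithinAt_iff_tendsto_slope]
  have hmem : ∀ᶠ y in 𝓝[s \ {x}] x, y ∈ s \ {x} := self_mem_nhdsWithin
  have heq : ∀ᶠ y in 𝓝[s \ {x}] x,
      ∫ t, slope (fun y => φ y t) x y ∂μ = slope (fun y => ∫ t, φ y t ∂μ) x y := by
    filter_upwards [hmem] with y hy
    simp only [slope_def_module]
    rw [integral_smul, integral_sub (hint y hy.1) (hint x hx)]
  refine Tendsto.congr' heq ?_
  refine tendsto_integral_filter_of_dominated_convergence g ?_ ?_ hg ?_
  · filter_upwards [hmem] with y hy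
    simp only [slope_def_module]
    exact (((hint y hy.1).sub (hint x hx)).smul _).aestronglyMeasurable
  · filter_upwards [hmem] with y hy
    filter_upwards [hderiv, hbound] with t h1 h2
    have h3 := hs.norm_image_sub_le_of_norm_hasDerivWithin_le h1 h2 hx hy.1
    have hyx : 0 < ‖y - x‖ := norm_pos_iff.2 (sub_ne_zero.2 hy.2)
    rw [slope_def_module, norm_smul, norm_inv, inv_mul_le_iff₀ hyx, mul_comm]
    exact h3
  · filter_upwards [hderiv] with t h1
    exact hasDerivWithinAt_iff_tendsto_slope.1 (h1 x hx)

/-! ### Derivatives of the transform -/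

/-- The integrand of the `n`-th derivative of the regular transform. -/
def derivIntegrand (L : ℂ → ℂ) (c : ℝ) (F : ℂ → ℂ) (n : ℕ) (x t : ℝ) : ℂ :=
  (t : ℂ) ^ n * iteratedDeriv n F ((x * t : ℝ) : ℂ) * kernel L c t

/-- The bound for the derivatives of the transform. The constant `A` depends only on the compact
interval, whereas `Y`, the radius in Cauchy's estimates for the derivatives of `F`, is arbitrary. -/
theorem exists_norm_derivIntegrand_le (hL : IsHalfPlaneWeight L) {I : Set ℝ}
    (hpos : IsOpen (I ∩ Ioi 0)) (hneg : IsOpen (I ∩ Iio 0)) {F : ℂ → ℂ}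
    (hF : F ∈ classA (trace L) I) {a b : ℝ} (ha : a ∈ I) (hb : b ∈ I) (ha0 : a ≤ 0) (hb0 : 0 ≤ b)
    {c : ℝ} (hc : 0 < c) :
    ∃ A : ℝ, 0 < A ∧ ∀ Y : ℝ, 0 < Y → ∃ C : ℝ, 0 < C ∧ ∀ n : ℕ, ∀ x ∈ Icc a b, ∀ t : ℝ, 0 < t →
      ‖derivIntegrand L c F n x t‖ ≤
        C * n.factorial * (A / Y * trace L n) ^ n * majorant t := by
  obtain ⟨q, hq0, hq1, hFq⟩ := exists_lt_one_norm_le_entireE hL hpos hneg hF ha hb ha0 hb0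
  obtain ⟨A, C₁, hA, hC₁, hK⟩ := exists_pow_mul_entireE_mul_norm_kernel_le hL hc hq0 hq1
  refine ⟨A, hA, fun Y hY => ?_⟩
  obtain ⟨C₂, hC₂, hFY⟩ := hFq Y hY
  refine ⟨C₂ * C₁, by positivity, fun n x hx t ht => ?_⟩
  have h1 : ‖iteratedDeriv n F ((x * t : ℝ) : ℂ)‖ ≤
      n.factorial * (C₂ * entireE (trace L) (q * t)) / Y ^ n :=
    Complex.norm_iteratedDeriv_le_of_forall_mem_sphere_norm_le n hY hF.1.diffContOnCl
      fun z hz => hFY x hx t ht z (by rw [← dist_eq_norm]; exact (Metric.mem_sphere.1 hz).le)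
  rw [derivIntegrand, norm_mul, norm_mul, norm_pow, Complex.norm_real, norm_of_nonneg ht.le]
  calc t ^ n * ‖iteratedDeriv n F ((x * t : ℝ) : ℂ)‖ * ‖kernel L c t‖
      ≤ t ^ n * (n.factorial * (C₂ * entireE (trace L) (q * t)) / Y ^ n) * ‖kernel L c t‖ := by
        gcongr
    _ = n.factorial * C₂ / Y ^ n * (t ^ n * entireE (trace L) (q * t) * ‖kernel L c t‖) := by ring
    _ ≤ n.factorial * C₂ / Y ^ n * (C₁ * (A * trace L n) ^ n * majorant t) :=
        mul_le_mul_of_nonneg_left (hK n t ht) (by positivity)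
    _ = C₂ * C₁ * n.factorial * (A / Y * trace L n) ^ n * majorant t := by
        rw [show A / Y * trace L n = A * trace L n / Y by ring, div_pow]
        ring

lemma aestronglyMeasurable_derivIntegrand (hL : IsHalfPlaneWeight L) {F : ℂ → ℂ}
    (hF : Differentiable ℂ F) {c : ℝ} (hc : 0 < c) (n : ℕ) (x : ℝ) (μ : Measure ℝ) :
    AEStronglyMeasurable (derivIntegrand L c F n x) μ := by
  have h1 : Continuous (iteratedDeriv n F) :=
    (hF.contDiff (n := ⊤)).continuous_iteratedDeriv n (by exact_mod_cast le_top)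
  have h2 : Continuous fun t : ℝ => (t : ℂ) ^ n * iteratedDeriv n F ((x * t : ℝ) : ℂ) := by
    fun_prop
  exact h2.aestronglyMeasurable.mul (aestronglyMeasurable_kernel hL hc μ)

lemma integrableOn_derivIntegrand (hL : IsHalfPlaneWeight L) {I : Set ℝ} (hI : I.OrdConnected)
    (h0 : (0 : ℝ) ∈ I) (hpos : IsOpen (I ∩ Ioi 0)) (hneg : IsOpen (I ∩ Iio 0)) {F : ℂ → ℂ}
    (hF : F ∈ classA (trace L) I) {c : ℝ} (hc : 0 < c) (n : ℕ) {x : ℝ} (hx : x ∈ I) :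
    IntegrableOn (derivIntegrand L c F n x) (Ioi 0) := by
  obtain ⟨a, b, ha0, hb0, hab, hxab, -⟩ := exists_Icc_mem_nhdsWithin hI h0 hpos hneg hx
  obtain ⟨A, hA, h⟩ := exists_norm_derivIntegrand_le hL hpos hneg hF
    (hab (left_mem_Icc.2 (ha0.trans hb0))) (hab (right_mem_Icc.2 (ha0.trans hb0))) ha0 hb0 hc
  obtain ⟨C, hC, h⟩ := h 1 one_pos
  refine Integrable.mono'
    (integrableOn_majorant.const_mul (C * n.factorial * (A / 1 * trace L n) ^ n))
    (aestronglyMeasurable_derivIntegrand hL hF.1 hc n x _) ?_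
  filter_upwards [ae_restrict_mem measurableSet_Ioi] with t ht using h n x hxab t ht

lemma hasDerivAt_derivIntegrand {F : ℂ → ℂ} (hF : Differentiable ℂ F) (L : ℂ → ℂ) (c : ℝ) (n : ℕ)
    (x t : ℝ) :
    HasDerivAt (fun x => derivIntegrand L c F n x t) (derivIntegrand L c F (n + 1) x t) x := by
  have h1 : HasDerivAt (iteratedDeriv n F) (iteratedDeriv (n + 1) F ((x * t : ℝ) : ℂ))
      ((x : ℂ) * (t : ℂ)) := by
    rw [iteratedDeriv_succ, Complex.ofReal_mul]
    exact ((hF.contDiff (n := ⊤)).differentiable_iteratedDeriv n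
      (by exact_mod_cast WithTop.coe_lt_top _) _).hasDerivAt
  have h2 : HasDerivAt (fun z : ℂ => z * (t : ℂ)) (1 * (t : ℂ)) (x : ℂ) :=
    (hasDerivAt_id (x : ℂ)).mul_const _
  have h3 := (((h1.comp (x : ℂ) h2).comp_ofReal).const_mul ((t : ℂ) ^ n)).mul_const
    (kernel L c t)
  simp only [derivIntegrand, Function.comp_def, ← Complex.ofReal_mul] at h3 ⊢
  refine h3.congr_deriv ?_
  rw [pow_succ]
  ring

lemma hasDerivWithinAt_integral_derivIntegrand (hL : IsHalfPlaneWeight L) {I : Set ℝ}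
    (hI : I.OrdConnected) (h0 : (0 : ℝ) ∈ I) (hpos : IsOpen (I ∩ Ioi 0))
    (hneg : IsOpen (I ∩ Iio 0)) {F : ℂ → ℂ} (hF : F ∈ classA (trace L) I) {c : ℝ} (hc : 0 < c)
    (n : ℕ) {x : ℝ} (hx : x ∈ I) :
    HasDerivWithinAt (fun x => ∫ t in Ioi (0 : ℝ), derivIntegrand L c F n x t)
      (∫ t in Ioi (0 : ℝ), derivIntegrand L c F (n + 1) x t) I x := by
  obtain ⟨a, b, ha0, hb0, hab, hxab, hnhds⟩ := exists_Icc_mem_nhdsWithin hI h0 hpos hneg hx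
  obtain ⟨A, hA, h⟩ := exists_norm_derivIntegrand_le hL hpos hneg hF
    (hab (left_mem_Icc.2 (ha0.trans hb0))) (hab (right_mem_Icc.2 (ha0.trans hb0))) ha0 hb0 hc
  obtain ⟨C, hC, h⟩ := h 1 one_pos
  refine HasDerivWithinAt.mono_of_mem_nhdsWithin ?_ hnhds
  refine hasDerivWithinAt_integral_of_convex (convex_Icc a b) hxab
    (fun y hy => integrableOn_derivIntegrand hL hI h0 hpos hneg hF hc n (hab hy))
    (Eventually.of_forall fun t y _ =>
      (hasDerivAt_derivIntegrand hF.1 L c n y t).hasDerivWithinAt) ?_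
    (integrableOn_majorant.const_mul
      (C * (n + 1).factorial * (A / 1 * trace L (n + 1 : ℕ)) ^ (n + 1)))
  filter_upwards [ae_restrict_mem measurableSet_Ioi] with t ht y hy using h (n + 1) y hy t ht

lemma regularTransform_eq (L : ℂ → ℂ) (c : ℝ) (F : ℂ → ℂ) :
    regularTransform L c F = fun x => ∫ t in Ioi (0 : ℝ), derivIntegrand L c F 0 x t := by
  ext x
  simp [regularTransform, derivIntegrand]

lemma iteratedDerivWithin_regularTransform (hL : IsHalfPlaneWeight L) {I : Set ℝ}
    (hI : I.OrdConnected) (h0 : (0 : ℝ) ∈ I) (hpos : IsOpen (I ∩ Ioi 0))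
    (hneg : IsOpen (I ∩ Iio 0)) (hu : UniqueDiffOn ℝ I) {F : ℂ → ℂ}
    (hF : F ∈ classA (trace L) I) {c : ℝ} (hc : 0 < c) (n : ℕ) :
    EqOn (iteratedDerivWithin n (regularTransform L c F) I)
      (fun x => ∫ t in Ioi (0 : ℝ), derivIntegrand L c F n x t) I := by
  induction n with
  | zero =>
    intro x _
    rw [iteratedDerivWithin_zero, regularTransform_eq]
  | succ n ih =>
    intro x hx
    rw [iteratedDerivWithin_succ, derivWithin_congr ih (ih hx)]
    exact (hasDerivWithinAt_integral_derivIntegrand hL hI h0 hpos hneg hF hc n hx).derivWithin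
      (hu x hx)

lemma contDiffOn_regularTransform (hL : IsHalfPlaneWeight L) {I : Set ℝ}
    (hI : I.OrdConnected) (h0 : (0 : ℝ) ∈ I) (hpos : IsOpen (I ∩ Ioi 0))
    (hneg : IsOpen (I ∩ Iio 0)) (hu : UniqueDiffOn ℝ I) {F : ℂ → ℂ}
    (hF : F ∈ classA (trace L) I) {c : ℝ} (hc : 0 < c) :
    ContDiffOn ℝ ∞ (regularTransform L c F) I := by
  refine contDiffOn_of_differentiableOn_deriv fun m _ => ?_
  refine DifferentiableOn.congr (fun x hx => ?_)
    (iteratedDerivWithin_regularTransform hL hI h0 hpos hneg hu hF hc m)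
  exact (hasDerivWithinAt_integral_derivIntegrand hL hI h0 hpos hneg hF hc m
    hx).differentiableWithinAt

theorem regularTransform_mem_beurlingClass (hL : IsHalfPlaneWeight L) {I : Set ℝ}
    (hI : I.OrdConnected) (h0 : (0 : ℝ) ∈ I) (hInt : I.Nontrivial) (hpos : IsOpen (I ∩ Ioi 0))
    (hneg : IsOpen (I ∩ Iio 0)) {F : ℂ → ℂ} (hF : F ∈ classA (trace L) I) {c : ℝ} (hc : 0 < c) :
    regularTransform L c F ∈ beurlingClass (trace L) I := by
  have hu : UniqueDiffOn ℝ I := uniqueDiffOn_convex hI.convex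
    (hI.convex.nontrivial_iff_nonempty_interior.1 hInt)
  refine ⟨contDiffOn_regularTransform hL hI h0 hpos hneg hu hF hc, fun a b hab δ hδ => ?_⟩
  rcases lt_or_ge b a with hba | hba
  · exact ⟨1, one_pos, fun n x hx => absurd (hx.1.trans hx.2) (not_le.2 hba)⟩
  have ha : min a 0 ∈ I := by
    rcases min_choice a 0 with h | h <;> rw [h]
    exacts [hab (left_mem_Icc.2 hba), h0]
  have hb : max b 0 ∈ I := by
    rcases max_choice b 0 with h | h <;> rw [h]
    exacts [hab (right_mem_Icc.2 hba), h0]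
  obtain ⟨A, hA, h⟩ := exists_norm_derivIntegrand_le hL hpos hneg hF ha hb (min_le_right _ _)
    (le_max_right _ _) hc
  -- The radius `A / δ` in Cauchy's estimates turns `A` into `δ`.
  obtain ⟨C, hC, h⟩ := h (A / δ) (by positivity)
  rw [div_div_cancel₀ hA.ne'] at h
  set J := ∫ t in Ioi (0 : ℝ), majorant t
  have hJ : 0 ≤ J := setIntegral_nonneg measurableSet_Ioi fun t ht => majorant_nonneg ht
  refine ⟨C * (J + 1), by positivity, fun n x hx => ?_⟩
  rw [iteratedDerivWithin_regularTransform hL hI h0 hpos hneg hu hF hc n (hab hx)]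
  have hpow : 0 ≤ (δ * trace L n) ^ n := by
    rcases Nat.eq_zero_or_pos n with h' | h'
    · simp [h']
    · have := hL.trace_pos (r := n) (by exact_mod_cast h')
      positivity
  have h1 : ‖∫ t in Ioi (0 : ℝ), derivIntegrand L c F n x t‖ ≤
      ∫ t in Ioi (0 : ℝ), C * n.factorial * (δ * trace L n) ^ n * majorant t := by
    refine norm_integral_le_of_norm_le (integrableOn_majorant.const_mul _) ?_
    filter_upwards [ae_restrict_mem measurableSet_Ioi] with t ht
    exact h n x ⟨(min_le_left _ _).trans hx.1, hx.2.trans (le_max_left _ _)⟩ t ht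
  rw [integral_const_mul] at h1
  have h2 : (n.factorial : ℝ) ≤ (n : ℝ) ^ n := by exact_mod_cast n.factorial_le_pow
  calc ‖∫ t in Ioi (0 : ℝ), derivIntegrand L c F n x t‖
      ≤ C * n.factorial * (δ * trace L n) ^ n * J := h1
    _ ≤ C * (n : ℝ) ^ n * (δ * trace L n) ^ n * (J + 1) := by
        gcongr
        linarith
    _ = C * (J + 1) * (δ * n * trace L n) ^ n := by
        rw [show δ * (n : ℝ) * trace L n = n * (δ * trace L n) by ring, mul_pow (n : ℝ)]
        ring

/-! ### Weights satisfying the general assumptions -/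

lemma halfPlane_subset_angle {a : ℝ} (ha : π / 2 < a) : halfPlane ⊆ angle a := fun _ hs =>
  ⟨norm_pos_iff.1 (norm_pos_of_mem_halfPlane hs), (abs_arg_lt_of_mem_halfPlane hs).trans ha⟩

lemma exists_forall_norm_ge_of_eventually {P : ℂ → Prop} {S : Set ℂ}
    (h : ∀ᶠ s in Bornology.cobounded ℂ ⊓ 𝓟 S, P s) : ∃ R : ℝ, ∀ s ∈ S, R ≤ ‖s‖ → P s := by
  rw [eventually_inf_principal, ← comap_norm_atTop, eventually_comap] at h
  obtain ⟨R, hR⟩ := eventually_atTop.1 h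
  exact ⟨R, fun s hs hRs => hR ‖s‖ hRs s rfl hs⟩

lemma hasDerivAt_ell (hd : DifferentiableOn ℂ L halfPlane)
    (him : ∀ r : ℝ, 0 < r → (L r).im = 0) (h1 : ∀ r : ℝ, 0 < r → 1 ≤ trace L r) (t : ℝ) :
    HasDerivAt (ell L) (eps L (exp t : ℝ)).re t := by
  have h := ((hasDerivAt_trace hd (exp_pos t)).comp t (hasDerivAt_exp t)).log
    (one_pos.trans_le (h1 _ (exp_pos t))).ne'
  refine h.congr_deriv ?_
  rw [eps_ofReal hd him (exp_pos t), Complex.ofReal_re, mul_comm (exp t), Function.comp_apply]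

lemma deriv_ell (hd : DifferentiableOn ℂ L halfPlane)
    (him : ∀ r : ℝ, 0 < r → (L r).im = 0) (h1 : ∀ r : ℝ, 0 < r → 1 ≤ trace L r) :
    deriv (ell L) = fun t : ℝ => (eps L (exp t : ℝ)).re :=
  funext fun t => (hasDerivAt_ell hd him h1 t).deriv

lemma differentiableAt_eps_exp (hd : DifferentiableOn ℂ L halfPlane)
    (h0 : ∀ s ∈ halfPlane, L s ≠ 0) (t : ℝ) :
    DifferentiableAt ℝ (fun t : ℝ => (eps L (exp t : ℝ)).re) t := by
  have hs := ofReal_mem_halfPlane (exp_pos t)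
  have h2 : DifferentiableAt ℂ (eps L) (exp t : ℝ) :=
    (differentiableAt_id.mul ((hd.deriv isOpen_halfPlane).differentiableAt
      (isOpen_halfPlane.mem_nhds hs))).div
        (hd.differentiableAt (isOpen_halfPlane.mem_nhds hs)) (h0 _ hs)
  have h3 := h2.hasDerivAt.real_of_complex
  exact (h3.comp t (hasDerivAt_exp t)).differentiableAt

/-- If `ℓ'` is eventually nonnegative, `ℓ'' = o(ℓ')` and `ℓ` is unbounded, then `ε` decays more
slowly than `r ^ (-1/2)`: the function `ℓ'(t) e^{t/2}` is eventually increasing. -/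
lemma exists_div_sqrt_le_eps (hd : DifferentiableOn ℂ L halfPlane)
    (h0 : ∀ s ∈ halfPlane, L s ≠ 0) (him : ∀ r : ℝ, 0 < r → (L r).im = 0)
    (h1 : ∀ r : ℝ, 0 < r → 1 ≤ trace L r) (hunb : Tendsto (trace L) atTop atTop)
    (hnn : ∀ᶠ t : ℝ in atTop, 0 ≤ deriv (ell L) t)
    (hlo : (fun t => deriv (deriv (ell L)) t) =o[atTop] (fun t => deriv (ell L) t)) :
    ∃ κ : ℝ, 0 < κ ∧ ∀ᶠ r : ℝ in atTop, κ / √r ≤ (eps L r).re := by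
  have hde := deriv_ell hd him h1
  obtain ⟨T, hT⟩ := eventually_atTop.1 (hnn.and (isLittleO_iff.1 hlo one_half_pos))
  set p := deriv (ell L)
  have hp : ∀ t, HasDerivAt p (deriv p t) t := fun t => by
    have := differentiableAt_eps_exp hd h0 t
    rw [← hde] at this
    exact this.hasDerivAt
  obtain ⟨t₀, ht₀, hpos⟩ : ∃ t₀, T ≤ t₀ ∧ 0 < p t₀ := by
    by_contra! hcon
    have hanti := antitoneOn_of_deriv_nonpos (convex_Ici T) (f := ell L)
      (fun x _ => (hasDerivAt_ell hd him h1 x).continuousAt.continuousWithinAt)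
      (fun x _ => (hasDerivAt_ell hd him h1 x).differentiableAt.differentiableWithinAt)
      (fun x hx => hcon x (interior_subset hx))
    have hlim : Tendsto (ell L) atTop atTop := tendsto_log_atTop.comp (hunb.comp tendsto_exp_atTop)
    obtain ⟨t, ht1, ht2⟩ := ((eventually_ge_atTop T).and
      (hlim.eventually_gt_atTop (ell L T))).exists
    exact (hanti self_mem_Ici ht1 ht1).not_gt ht2
  have hd2 : ∀ t, HasDerivAt (fun t => p t * exp (t / 2))
      (deriv p t * exp (t / 2) + p t * (exp (t / 2) * (1 / 2))) t := fun t =>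
    (hp t).mul ((hasDerivAt_id t).div_const 2).exp
  have hmono := monotoneOn_of_deriv_nonneg (convex_Ici t₀)
    (fun x _ => (hd2 x).continuousAt.continuousWithinAt)
    (fun x _ => (hd2 x).differentiableAt.differentiableWithinAt)
    (fun x hx => by
      obtain ⟨h2, h3⟩ := hT x (ht₀.trans (interior_subset hx))
      rw [(hd2 x).deriv]
      rw [norm_eq_abs, norm_of_nonneg h2] at h3
      have := (abs_le.1 h3).1
      have he := exp_pos (x / 2)
      nlinarith)
  refine ⟨p t₀ * exp (t₀ / 2), by positivity, ?_⟩
  filter_upwards [eventually_ge_atTop (exp t₀)] with r hr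
  have hr0 : 0 < r := (exp_pos _).trans_le hr
  have hlog : t₀ ≤ Real.log r := (le_log_iff_exp_le hr0).2 hr
  have h2 := hmono self_mem_Ici (show Real.log r ∈ Ici t₀ from hlog) hlog
  have h3 : exp (Real.log r / 2) = √r := by
    rw [exp_half, exp_log hr0]
  simp only at h2
  rw [h3, hde] at h2
  simp only [exp_log hr0] at h2
  rw [div_le_iff₀ (sqrt_pos.2 hr0), hde]
  exact h2

theorem isHalfPlaneWeight_of_isWeight {a : ℝ} (ha : π / 2 < a) (hL : IsWeight a L) (h3 : R3 L)
    (h8 : R8 a L) : IsHalfPlaneWeight L := by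
  have hsub := halfPlane_subset_angle ha
  have hd : DifferentiableOn ℂ L halfPlane := hL.analytic.mono hsub
  have h0 : ∀ s ∈ halfPlane, L s ≠ 0 := fun s hs => hL.ne_zero s (hsub hs)
  have him : ∀ r : ℝ, 0 < r → (L r).im = 0 := fun r hr => hL.im_eq_zero r hr.le
  have h1 : ∀ r : ℝ, 0 < r → 1 ≤ trace L r := fun r hr => hL.one_le r hr.le
  have hde := deriv_ell hd him h1
  have hnn : ∀ᶠ t : ℝ in atTop, 0 ≤ deriv (ell L) t := by
    obtain ⟨ρ₀, hρ₀⟩ := hL.eventually_mono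
    filter_upwards [tendsto_exp_atTop.eventually_gt_atTop ρ₀] with t ht
    have h4 : 0 ≤ deriv (trace L) (exp t) := by
      rw [← derivWithin_of_mem_nhds (Ici_mem_nhds ht)]
      exact hρ₀.derivWithin_nonneg
    rw [(hasDerivAt_trace hd (exp_pos t)).deriv] at h4
    rw [hde]
    simp only
    rw [eps_ofReal hd him (exp_pos t), Complex.ofReal_re]
    have := one_pos.trans_le (h1 _ (exp_pos t))
    positivity
  obtain ⟨κ, hκ, hκe⟩ := exists_div_sqrt_le_eps hd h0 him h1 hL.unbounded hnn h3.2
  refine ⟨him, h1, hL.unbounded, hd, h0, ?_, ⟨κ, hκ, hκe⟩, fun η hη => ?_⟩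
  · obtain ⟨M, hM⟩ := h3.1
    refine ⟨max M 0, le_max_right _ _, ?_⟩
    filter_upwards [tendsto_log_atTop.eventually hM, eventually_gt_atTop 0] with r hr hr0
    rw [hde] at hr
    simp only [exp_log hr0] at hr
    exact hr.trans (le_max_left _ _)
  · obtain ⟨R₁, hR₁⟩ := exists_forall_norm_ge_of_eventually (isLittleO_iff.1 h8 hη)
    obtain ⟨R₂, hR₂⟩ := eventually_atTop.1 hκe
    refine ⟨max R₁ R₂, fun s hs hRs => ?_⟩
    have hn := norm_pos_of_mem_halfPlane hs
    have h5 := hR₁ s (hsub hs) ((le_max_left _ _).trans hRs)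
    have h6 : 0 ≤ (eps L (‖s‖ : ℝ)).re :=
      le_trans (by positivity) (hR₂ ‖s‖ ((le_max_right _ _).trans hRs))
    have h7 : ‖eps L (‖s‖ : ℝ)‖ = (eps L (‖s‖ : ℝ)).re := by
      rw [eps_ofReal hd him hn, Complex.norm_real, Complex.ofReal_re, norm_of_nonneg]
      rwa [eps_ofReal hd him hn, Complex.ofReal_re] at h6
    rwa [h7] at h5

/-! ### Iterated logarithms -/

/-- The trace at infinity of the right half-plane. -/
def halfPlaneInfty : Filter ℂ := Bornology.cobounded ℂ ⊓ 𝓟 halfPlane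

lemma tendsto_norm_halfPlaneInfty : Tendsto (fun s : ℂ => ‖s‖) halfPlaneInfty atTop :=
  tendsto_norm_cobounded_atTop.mono_left inf_le_left

lemma eventually_mem_halfPlane : ∀ᶠ s in halfPlaneInfty, s ∈ halfPlane :=
  mem_inf_of_right (mem_principal_self _)

lemma one_le_exp_iterate (m : ℕ) : 1 ≤ (Real.exp)^[m] 1 := by
  induction m with
  | zero => simp
  | succ m ih =>
    rw [Function.iterate_succ_apply']
    exact one_le_exp (zero_le_one.trans ih)

lemma exp_iterate_le_of_le {m k : ℕ} (h : m ≤ k) : (Real.exp)^[m] 1 ≤ (Real.exp)^[k] 1 := by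
  induction k, h using Nat.le_induction with
  | base => exact le_rfl
  | succ k _ ih =>
    rw [Function.iterate_succ_apply']
    linarith [add_one_le_exp ((Real.exp)^[k] 1)]

lemma exp_iterate_lt_log_iterate_re (j : ℕ) : ∀ (m : ℕ) (z : ℂ), (Real.exp)^[m + j] 1 < z.re →
    (Real.exp)^[m] 1 < ((Complex.log)^[j] z).re := by
  induction j with
  | zero => exact fun m z hz => hz
  | succ j ih =>
    intro m z hz
    have h1 := ih (m + 1) z (by rwa [add_right_comm])
    rw [Function.iterate_succ_apply'] at h1
    rw [Function.iterate_succ_apply', Complex.log_re]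
    have h2 := h1.trans_le (Complex.re_le_norm _)
    exact (lt_log_iff_exp_lt ((exp_pos _).trans h2)).2 h2

/-- The iterated logarithms entering the `k`-th factor have real part larger than one. -/
lemma one_lt_log_iterate_re {j k : ℕ} (hjk : j ≤ k) {z : ℂ} (hz : (Real.exp)^[k] 1 < z.re) :
    1 < ((Complex.log)^[j] z).re := by
  have := exp_iterate_lt_log_iterate_re j 0 z
    (lt_of_le_of_lt (exp_iterate_le_of_le (by simpa using hjk)) hz)
  simpa using this

lemma log_iterate_ofReal {j k : ℕ} (hjk : j ≤ k) {x : ℝ} (hx : (Real.exp)^[k] 1 < x) :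
    (Complex.log)^[j] (x : ℂ) = (((Real.log)^[j] x : ℝ) : ℂ) := by
  induction j with
  | zero => rfl
  | succ j ih =>
    have h1 := ih (by omega)
    have h2 := one_lt_log_iterate_re (j := j) (k := k) (by omega) (z := (x : ℂ)) (by simpa using hx)
    rw [h1, Complex.ofReal_re] at h2
    rw [Function.iterate_succ_apply', Function.iterate_succ_apply', h1,
      Complex.ofReal_log (by linarith)]

lemma one_lt_log_iterate {j k : ℕ} (hjk : j ≤ k) {x : ℝ} (hx : (Real.exp)^[k] 1 < x) :
    1 < (Real.log)^[j] x := by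
  have := one_lt_log_iterate_re hjk (z := (x : ℂ)) (by simpa using hx)
  rwa [log_iterate_ofReal hjk hx, Complex.ofReal_re] at this

lemma log_iterate_succ_le_log {j k : ℕ} (hjk : j < k) {x : ℝ} (hx : (Real.exp)^[k] 1 < x) :
    (Real.log)^[j + 1] x ≤ Real.log x := by
  induction j with
  | zero => rfl
  | succ j ih =>
    rw [Function.iterate_succ_apply']
    exact (log_le_self (zero_le_one.trans (one_lt_log_iterate (by omega) hx).le)).trans
      (ih (by omega))

lemma tendsto_log_iterate_atTop (j : ℕ) : Tendsto (Real.log)^[j] atTop atTop := by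
  induction j with
  | zero => exact tendsto_id
  | succ j ih =>
    rw [Function.iterate_succ']
    exact tendsto_log_atTop.comp ih

lemma mem_slitPlane_of_one_lt_re {z : ℂ} (hz : 1 < z.re) : z ∈ Complex.slitPlane :=
  Or.inl (one_pos.trans hz)

lemma ne_zero_of_one_lt_re {z : ℂ} (hz : 1 < z.re) : z ≠ 0 :=
  Complex.slitPlane_ne_zero (mem_slitPlane_of_one_lt_re hz)

lemma hasDerivAt_log_iterate {j k : ℕ} (hjk : j ≤ k) {z : ℂ} (hz : (Real.exp)^[k] 1 < z.re) :
    HasDerivAt (Complex.log)^[j] (∏ i ∈ Finset.range j, ((Complex.log)^[i] z)⁻¹) z := by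
  induction j with
  | zero => simpa using hasDerivAt_id z
  | succ j ih =>
    rw [Function.iterate_succ', Finset.prod_range_succ]
    exact (ih (by omega)).clog
      (mem_slitPlane_of_one_lt_re (one_lt_log_iterate_re (by omega) hz))

lemma exp_iterate_lt_add {k : ℕ} {s : ℂ} (hs : s ∈ halfPlane) :
    (Real.exp)^[k] 1 < (s + (((Real.exp)^[k] 1 : ℝ) : ℂ)).re := by
  have : 0 < s.re := hs
  simpa using this

/-! ### Comparison of logarithms on the half-plane and on the ray -/

/-- Taking logarithms improves a bounded quotient to a quotient tending to one. -/
lemma tendsto_log_div_log {l : Filter ℂ} {z : ℂ → ℂ} {v : ℂ → ℝ} {B : ℝ} (hv : Tendsto v l atTop)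
    (hz : ∀ᶠ s in l, z s ≠ 0) (hB : ∀ᶠ s in l, ‖Complex.log (z s / v s)‖ ≤ B) :
    Tendsto (fun s => Complex.log (z s) / (Real.log (v s) : ℂ)) l (𝓝 1) := by
  have hlog : Tendsto (fun s => Real.log (v s)) l atTop := tendsto_log_atTop.comp hv
  have h1 : Tendsto (fun s => Complex.log (z s / v s) / (Real.log (v s) : ℂ)) l (𝓝 0) := by
    refine squeeze_zero_norm' (a := fun s => B / Real.log (v s)) ?_ (hlog.const_div_atTop B)
    filter_upwards [hB, hlog.eventually_gt_atTop 0] with s h2 h3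
    rw [norm_div, Complex.norm_real, norm_of_nonneg h3.le]
    gcongr
  have h2 := h1.const_add 1
  rw [add_zero] at h2
  refine h2.congr' ?_
  filter_upwards [hz, hv.eventually_gt_atTop 0, hlog.eventually_gt_atTop 0] with s h3 h4 h5
  have h4' : (v s : ℂ) ≠ 0 := by exact_mod_cast h4.ne'
  have h5' : (Real.log (v s) : ℂ) ≠ 0 := by exact_mod_cast h5.ne'
  have h6 : z s = (v s : ℂ) * (z s / v s) := by field_simp
  nth_rewrite 2 [h6]
  rw [Complex.log_ofReal_mul h4 (div_ne_zero h3 h4'), add_div, div_self h5']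

lemma tendsto_norm_add (e : ℝ) : Tendsto (fun s : ℂ => ‖s‖ + e) halfPlaneInfty atTop :=
  tendsto_atTop_add_const_right _ e tendsto_norm_halfPlaneInfty

lemma eventually_norm_log_add_div_le {e : ℝ} (he : 0 ≤ e) : ∀ᶠ s in halfPlaneInfty,
    ‖Complex.log ((s + (e : ℂ)) / ((‖s‖ + e : ℝ) : ℂ))‖ ≤ Real.log 2 + π := by
  filter_upwards [eventually_mem_halfPlane,
    tendsto_norm_halfPlaneInfty.eventually_ge_atTop e] with s hs hse
  have hs' : 0 < s.re := hs
  have hn := norm_pos_of_mem_halfPlane hs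
  have hse0 : 0 < ‖s‖ + e := by linarith
  have h1 : ‖s‖ ≤ ‖s + (e : ℂ)‖ := by
    rw [← sq_le_sq₀ (norm_nonneg _) (norm_nonneg _), ← Complex.normSq_eq_norm_sq,
      ← Complex.normSq_eq_norm_sq, Complex.normSq_apply, Complex.normSq_apply]
    simp only [Complex.add_re, Complex.ofReal_re, Complex.add_im, Complex.ofReal_im, add_zero]
    nlinarith
  have h2 : ‖s + (e : ℂ)‖ ≤ ‖s‖ + e := by
    refine (norm_add_le _ _).trans ?_
    rw [Complex.norm_real, norm_of_nonneg he]
  set w := (s + (e : ℂ)) / ((‖s‖ + e : ℝ) : ℂ)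
  have hw : ‖w‖ = ‖s + (e : ℂ)‖ / (‖s‖ + e) := by
    rw [norm_div, Complex.norm_real, norm_of_nonneg hse0.le]
  have hw1 : ‖w‖ ≤ 1 := by rw [hw, div_le_one hse0]; exact h2
  have hw2 : 2⁻¹ ≤ ‖w‖ := by
    rw [hw, le_div_iff₀ hse0]
    linarith
  have hw0 : 0 < ‖w‖ := by linarith
  refine (Complex.norm_le_abs_re_add_abs_im _).trans (add_le_add ?_ ?_)
  · rw [Complex.log_re, abs_of_nonpos (log_nonpos hw0.le hw1), neg_le, ← log_inv]
    exact log_le_log (by norm_num) hw2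
  · rw [Complex.log_im]
    exact Complex.abs_arg_le_pi _

/-- Uniformly in the half-plane, iterated logarithms are asymptotic to their values on the ray. -/
lemma tendsto_log_iterate_div {e : ℝ} (he : 0 ≤ e) (j : ℕ)
    (hne : ∀ i ≤ j, ∀ s ∈ halfPlane, (Complex.log)^[i] (s + (e : ℂ)) ≠ 0) :
    Tendsto (fun s : ℂ => (Complex.log)^[j + 1] (s + (e : ℂ)) /
      (((Real.log)^[j + 1] (‖s‖ + e) : ℝ) : ℂ)) halfPlaneInfty (𝓝 1) := by
  induction j with
  | zero =>
    refine tendsto_log_div_log (tendsto_norm_add e) ?_ (eventually_norm_log_add_div_le he)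
    filter_upwards [eventually_mem_halfPlane] with s hs using hne 0 le_rfl s hs
  | succ j ih =>
    have h1 := ih fun i hi => hne i (by omega)
    simp only [Function.iterate_succ_apply' _ (j + 1)]
    refine tendsto_log_div_log (B := 1)
      ((tendsto_log_iterate_atTop (j + 1)).comp (tendsto_norm_add e)) ?_ ?_
    · filter_upwards [eventually_mem_halfPlane] with s hs using hne (j + 1) le_rfl s hs
    · have h2 := (continuousAt_clog (x := 1) (by simp)).tendsto.comp h1
      rw [Complex.log_one] at h2
      have h3 := h2.norm
      rw [norm_zero] at h3
      filter_upwards [h3.eventually_le_const one_pos] with s hs using hs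

lemma tendsto_div_add_halfPlaneInfty (e : ℝ) :
    Tendsto (fun s : ℂ => s / (s + (e : ℂ))) halfPlaneInfty (𝓝 1) := by
  have h1 : Tendsto (fun s : ℂ => 1 + (e : ℂ) * s⁻¹) halfPlaneInfty (𝓝 1) := by
    have : Tendsto (fun s : ℂ => (e : ℂ) * s⁻¹) halfPlaneInfty (𝓝 ((e : ℂ) * 0)) :=
      ((tendsto_inv₀_cobounded (α := ℂ)).mono_left
      (inf_le_left (b := 𝓟 halfPlane))).const_mul (e : ℂ)
    simpa only [mul_zero, add_zero] using this.const_add 1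
  have h2 := h1.inv₀ one_ne_zero
  rw [inv_one] at h2
  refine h2.congr' ?_
  filter_upwards [eventually_mem_halfPlane] with s hs
  have hs0 : s ≠ 0 := norm_pos_iff.1 (norm_pos_of_mem_halfPlane hs)
  rw [show 1 + (e : ℂ) * s⁻¹ = (s + e) / s by field_simp, inv_div]

lemma tendsto_norm_div_add_halfPlaneInfty (e : ℝ) :
    Tendsto (fun s : ℂ => ((‖s‖ : ℝ) : ℂ) / ((‖s‖ : ℝ) + (e : ℂ))) halfPlaneInfty (𝓝 1) := by
  refine (tendsto_div_add_halfPlaneInfty e).comp (f := fun s : ℂ => ((‖s‖ : ℝ) : ℂ)) ?_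
  refine tendsto_inf.2 ⟨?_, tendsto_principal.2 ?_⟩
  · rw [← tendsto_norm_atTop_iff_cobounded]
    simpa using tendsto_norm_halfPlaneInfty
  · filter_upwards [eventually_mem_halfPlane] with s hs
    exact ofReal_mem_halfPlane (norm_pos_of_mem_halfPlane hs)

/-! ### Denjoy weights -/

/-- The properties of a summand of `ε` for a Denjoy weight: up to constants it lies between
`r ^ (-1/2)` and `1` on the positive ray, and it is uniformly asymptotic to its value there. -/
structure IsSlowTerm (T : ℂ → ℂ) : Prop where
  real : ∀ r : ℝ, 0 < r → T r = ((T r).re : ℂ)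
  lower : ∃ κ : ℝ, 0 < κ ∧ ∀ᶠ r : ℝ in atTop, κ / √r ≤ (T r).re
  upper : ∀ᶠ r : ℝ in atTop, (T r).re ≤ 1
  ratio : Tendsto (fun s : ℂ => T s / T (‖s‖ : ℝ)) halfPlaneInfty (𝓝 1)

namespace IsSlowTerm

variable {T : ℂ → ℂ}

lemma eventually_pos (hT : IsSlowTerm T) : ∀ᶠ r : ℝ in atTop, 0 < (T r).re := by
  obtain ⟨κ, hκ, h⟩ := hT.lower
  filter_upwards [h, eventually_gt_atTop 0] with r hr hr0
  exact lt_of_lt_of_le (by positivity) hr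

lemma eventually_norm_sub_le (hT : IsSlowTerm T) {η : ℝ} (hη : 0 < η) :
    ∀ᶠ s in halfPlaneInfty, ‖T s - T (‖s‖ : ℝ)‖ ≤ η * (T (‖s‖ : ℝ)).re := by
  have h1 := hT.ratio.sub_const 1
  rw [sub_self] at h1
  have h2 := h1.norm
  rw [norm_zero] at h2
  filter_upwards [h2.eventually_le_const hη, eventually_mem_halfPlane,
    tendsto_norm_halfPlaneInfty.eventually hT.eventually_pos] with s h3 hs h4
  have h5 : T (‖s‖ : ℝ) = ((T (‖s‖ : ℝ)).re : ℂ) := hT.real _ (norm_pos_of_mem_halfPlane hs)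
  have h6 : ‖T (‖s‖ : ℝ)‖ = (T (‖s‖ : ℝ)).re := by
    rw [h5, Complex.norm_real, Complex.ofReal_re, norm_of_nonneg h4.le]
  have h7 : T (‖s‖ : ℝ) ≠ 0 := norm_pos_iff.1 (h6 ▸ h4)
  rw [div_sub_one h7, norm_div, h6, div_le_iff₀ h4] at h3
  exact h3

end IsSlowTerm

lemma isHalfPlaneWeight_of_eps_eq_sum (him : ∀ r : ℝ, 0 < r → (L r).im = 0)
    (h1 : ∀ r : ℝ, 0 < r → 1 ≤ trace L r) (hunb : Tendsto (trace L) atTop atTop)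
    (hd : DifferentiableOn ℂ L halfPlane) (h0 : ∀ s ∈ halfPlane, L s ≠ 0) {S : Finset ℕ}
    {α : ℕ → ℝ} {T : ℕ → ℂ → ℂ} (hα : ∀ k ∈ S, 0 < α k) (hS : S.Nonempty)
    (hT : ∀ k ∈ S, IsSlowTerm (T k))
    (heps : ∀ s ∈ halfPlane, eps L s = ∑ k ∈ S, (α k : ℂ) * T k s) : IsHalfPlaneWeight L := by
  have hre : ∀ r : ℝ, 0 < r → (eps L r).re = ∑ k ∈ S, α k * (T k r).re := fun r hr => by
    rw [heps _ (ofReal_mem_halfPlane hr), Complex.re_sum]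
    simp
  refine ⟨him, h1, hunb, hd, h0, ⟨∑ k ∈ S, α k, Finset.sum_nonneg fun k hk => (hα k hk).le, ?_⟩,
    ?_, fun η hη => exists_forall_norm_ge_of_eventually ?_⟩
  · filter_upwards [(Finset.eventually_all S).2 fun k hk => (hT k hk).upper,
      eventually_gt_atTop 0] with r hr hr0
    rw [hre r hr0]
    exact Finset.sum_le_sum fun k hk => mul_le_of_le_one_right (hα k hk).le (hr k hk)
  · obtain ⟨k₀, hk₀⟩ := hS
    obtain ⟨κ, hκ, hκe⟩ := (hT k₀ hk₀).lower
    refine ⟨α k₀ * κ, mul_pos (hα k₀ hk₀) hκ, ?_⟩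
    filter_upwards [(Finset.eventually_all S).2 fun k hk => (hT k hk).eventually_pos, hκe,
      eventually_gt_atTop 0] with r hr hr1 hr0
    rw [hre r hr0, mul_div_assoc]
    exact (mul_le_mul_of_nonneg_left hr1 (hα k₀ hk₀).le).trans
      (Finset.single_le_sum (f := fun k => α k * (T k r).re)
        (fun k hk => mul_nonneg (hα k hk).le (hr k hk).le) hk₀)
  · filter_upwards [(Finset.eventually_all S).2 fun k hk => (hT k hk).eventually_norm_sub_le hη,
      eventually_mem_halfPlane] with s hs hsH
    have hn := norm_pos_of_mem_halfPlane hsH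
    rw [hre _ hn, heps _ hsH, heps _ (ofReal_mem_halfPlane hn), ← Finset.sum_sub_distrib,
      Finset.mul_sum]
    refine norm_sum_le_of_le S fun k hk => ?_
    rw [← mul_sub, norm_mul, Complex.norm_real, norm_of_nonneg (hα k hk).le]
    calc α k * ‖T k s - T k (‖s‖ : ℝ)‖ ≤ α k * (η * (T k (‖s‖ : ℝ)).re) :=
          mul_le_mul_of_nonneg_left (hs k hk) (hα k hk).le
      _ = η * (α k * (T k (‖s‖ : ℝ)).re) := by ring

lemma eventually_log_add_pow_le_sqrt (e : ℝ) (k : ℕ) :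
    ∀ᶠ r : ℝ in atTop, Real.log (r + e) ^ k ≤ 2 * √r := by
  have h := (isLittleO_log_rpow_rpow_atTop (k : ℝ) one_half_pos).bound one_pos
  filter_upwards [(tendsto_atTop_add_const_right _ e tendsto_id).eventually h,
    (tendsto_atTop_add_const_right _ e tendsto_id).eventually_ge_atTop (0 : ℝ),
    eventually_ge_atTop e, eventually_ge_atTop 0] with r hr hr1 hre hr0
  simp only [id] at hr hr1
  rw [rpow_natCast, one_mul, ← sqrt_eq_rpow, norm_of_nonneg (sqrt_nonneg _)] at hr
  calc Real.log (r + e) ^ k ≤ √(r + e) := (le_norm_self _).trans hr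
    _ ≤ √(2 ^ 2 * r) := sqrt_le_sqrt (by linarith)
    _ = 2 * √r := by rw [sqrt_mul (by norm_num), sqrt_sq (by norm_num)]

lemma half_le_div_add {r e : ℝ} (he : 0 ≤ e) (hr : 0 < r) (hre : e ≤ r) :
    1 / 2 ≤ r / (r + e) := by
  rw [div_le_div_iff₀ two_pos (by linarith)]
  linarith

/-- The logarithmic derivative `s f'(s) / f(s)` of `f(s) = log_k (s + exp_k 1)`. -/
def iterTerm (k : ℕ) (s : ℂ) : ℂ :=
  s / (s + (((Real.exp)^[k] 1 : ℝ) : ℂ)) *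
    ∏ i ∈ Finset.range k, ((Complex.log)^[i + 1] (s + (((Real.exp)^[k] 1 : ℝ) : ℂ)))⁻¹

lemma log_iterate_add_ofReal {i k : ℕ} (hik : i ≤ k) {r : ℝ} (hr : 0 < r) :
    (Complex.log)^[i] ((r : ℂ) + (((Real.exp)^[k] 1 : ℝ) : ℂ)) =
      (((Real.log)^[i] (r + (Real.exp)^[k] 1) : ℝ) : ℂ) := by
  rw [← Complex.ofReal_add]
  exact log_iterate_ofReal hik (by linarith)

lemma iterTerm_ofReal (k : ℕ) {r : ℝ} (hr : 0 < r) :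
    iterTerm k r = ((r / (r + (Real.exp)^[k] 1) *
      ∏ i ∈ Finset.range k, ((Real.log)^[i + 1] (r + (Real.exp)^[k] 1))⁻¹ : ℝ) : ℂ) := by
  rw [iterTerm, Complex.ofReal_mul, Complex.ofReal_div, Complex.ofReal_add, Complex.ofReal_prod]
  congr 1
  refine Finset.prod_congr rfl fun i hi => ?_
  rw [log_iterate_add_ofReal (by have := Finset.mem_range.1 hi; omega) hr, Complex.ofReal_inv]

lemma isSlowTerm_iterTerm (k : ℕ) : IsSlowTerm (iterTerm k) := by
  set e := (Real.exp)^[k] 1 with he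
  have he1 : 1 ≤ e := one_le_exp_iterate k
  have he0 : 0 ≤ e := zero_le_one.trans he1
  have hlog : ∀ r : ℝ, 0 < r → ∀ i < k, 1 < (Real.log)^[i + 1] (r + e) := fun r hr i hi =>
    one_lt_log_iterate (k := k) hi (by linarith)
  refine ⟨fun r hr => by rw [iterTerm_ofReal k hr, Complex.ofReal_re], ⟨1 / 4, by norm_num, ?_⟩,
    ?_, ?_⟩
  · filter_upwards [eventually_log_add_pow_le_sqrt e k, eventually_ge_atTop e,
      eventually_gt_atTop 0] with r hr hre hr0
    rw [iterTerm_ofReal k hr0, Complex.ofReal_re, ← he]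
    have hx : 1 < r + e := by linarith
    have hlx : 0 < Real.log (r + e) := log_pos hx
    have h1 : (Real.log (r + e))⁻¹ ^ k ≤
        ∏ i ∈ Finset.range k, ((Real.log)^[i + 1] (r + e))⁻¹ := by
      have := Finset.prod_le_prod (s := Finset.range k) (f := fun _ => (Real.log (r + e))⁻¹)
        (g := fun i => ((Real.log)^[i + 1] (r + e))⁻¹) (fun i _ => by positivity)
        (fun i hi => by
          have hi' := Finset.mem_range.1 hi
          exact inv_anti₀ (one_pos.trans (hlog r hr0 i hi'))
            (log_iterate_succ_le_log (k := k) hi' (by linarith)))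
      rwa [Finset.prod_const, Finset.card_range] at this
    have h2 : (2 * √r)⁻¹ ≤ (Real.log (r + e))⁻¹ ^ k := by
      rw [inv_pow]
      exact inv_anti₀ (by positivity) hr
    calc 1 / 4 / √r = 1 / 2 * (2 * √r)⁻¹ := by rw [mul_inv]; ring
      _ ≤ r / (r + e) * ∏ i ∈ Finset.range k, ((Real.log)^[i + 1] (r + e))⁻¹ :=
        mul_le_mul (half_le_div_add he0 hr0 hre) (h2.trans h1) (by positivity) (by positivity)
  · filter_upwards [eventually_gt_atTop 0] with r hr0
    rw [iterTerm_ofReal k hr0, Complex.ofReal_re, ← he]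
    refine mul_le_one₀ (by rw [div_le_one (by linarith)]; linarith)
      (Finset.prod_nonneg fun i hi => ?_) (Finset.prod_le_one (fun i hi => ?_) fun i hi => ?_)
    · exact inv_nonneg.2 (zero_le_one.trans (hlog r hr0 i (Finset.mem_range.1 hi)).le)
    · exact inv_nonneg.2 (zero_le_one.trans (hlog r hr0 i (Finset.mem_range.1 hi)).le)
    · exact inv_le_one_of_one_le₀ (hlog r hr0 i (Finset.mem_range.1 hi)).le
  · have h1 : Tendsto (fun s : ℂ => ∏ i ∈ Finset.range k, ((Complex.log)^[i + 1] (s + (e : ℂ)) /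
        (((Real.log)^[i + 1] (‖s‖ + e) : ℝ) : ℂ))⁻¹) halfPlaneInfty
        (𝓝 (∏ i ∈ Finset.range k, (1 : ℂ)⁻¹)) := by
      refine tendsto_finsetProd _ fun i hi => ?_
      have hi' := Finset.mem_range.1 hi
      exact (tendsto_log_iterate_div he0 i fun j hj s hs => ne_zero_of_one_lt_re
        (one_lt_log_iterate_re (k := k) (by omega) (exp_iterate_lt_add hs))).inv₀ one_ne_zero
    have h2 := ((tendsto_div_add_halfPlaneInfty e).div (tendsto_norm_div_add_halfPlaneInfty e)
      one_ne_zero).mul h1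
    simp only [inv_one, Finset.prod_const_one, div_one, mul_one] at h2
    refine h2.congr' ?_
    filter_upwards [eventually_mem_halfPlane] with s hs
    rw [iterTerm, iterTerm, ← he, mul_div_mul_comm, ← Finset.prod_div_distrib]
    congr 1
    refine Finset.prod_congr rfl fun i hi => ?_
    rw [log_iterate_add_ofReal (by have := Finset.mem_range.1 hi; omega)
      (norm_pos_of_mem_halfPlane hs), inv_div, inv_div_inv]

/-- The logarithmic derivative `s f'(s) / f(s)` of `f(s) = exp (log ^ β (s + 1))` is `β` times this
function. -/
def logTerm (β : ℝ) (s : ℂ) : ℂ :=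
  Complex.log (s + 1) ^ ((β - 1 : ℝ) : ℂ) * (s / (s + 1))

lemma log_add_one_ofReal {r : ℝ} (hr : 0 < r) :
    Complex.log ((r : ℂ) + 1) = (Real.log (r + 1) : ℂ) := by
  rw [Complex.ofReal_log (by linarith)]
  push_cast
  rfl

lemma log_add_one_pos {r : ℝ} (hr : 0 < r) : 0 < Real.log (r + 1) := log_pos (by linarith)

lemma log_add_one_re_pos {s : ℂ} (hs : s ∈ halfPlane) : 0 < (Complex.log (s + 1)).re := by
  rw [Complex.log_re]
  refine log_pos (lt_of_lt_of_le ?_ (Complex.re_le_norm _))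
  have : 0 < s.re := hs
  simpa using this

lemma add_one_mem_slitPlane {s : ℂ} (hs : s ∈ halfPlane) : s + 1 ∈ Complex.slitPlane := by
  have : 0 < s.re := hs
  refine Or.inl ?_
  rw [Complex.add_re, Complex.one_re]
  linarith

lemma logTerm_ofReal (β : ℝ) {r : ℝ} (hr : 0 < r) :
    logTerm β r = ((Real.log (r + 1) ^ (β - 1) * (r / (r + 1)) : ℝ) : ℂ) := by
  rw [logTerm, log_add_one_ofReal hr, Complex.ofReal_mul,
    Complex.ofReal_cpow (log_add_one_pos hr).le]
  push_cast
  rfl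

lemma isSlowTerm_logTerm {β : ℝ} (hβ0 : 0 ≤ β) (hβ1 : β < 1) : IsSlowTerm (logTerm β) := by
  have hlog1 : ∀ᶠ r : ℝ in atTop, 1 ≤ Real.log (r + 1) :=
    (tendsto_log_atTop.comp (tendsto_atTop_add_const_right _ 1 tendsto_id)).eventually_ge_atTop 1
  refine ⟨fun r hr => by rw [logTerm_ofReal β hr, Complex.ofReal_re], ⟨1 / 4, by norm_num, ?_⟩,
    ?_, ?_⟩
  · filter_upwards [eventually_log_add_pow_le_sqrt 1 1, hlog1, eventually_ge_atTop 1,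
      eventually_gt_atTop 0] with r hr hl hr1 hr0
    rw [logTerm_ofReal β hr0, Complex.ofReal_re]
    have h1 : (2 * √r)⁻¹ ≤ Real.log (r + 1) ^ (β - 1) := by
      calc (2 * √r)⁻¹ ≤ (Real.log (r + 1) ^ 1)⁻¹ := inv_anti₀ (by positivity) hr
        _ = Real.log (r + 1) ^ (-1 : ℝ) := by rw [pow_one, rpow_neg_one]
        _ ≤ Real.log (r + 1) ^ (β - 1) := rpow_le_rpow_of_exponent_le hl (by linarith)
    calc 1 / 4 / √r = (2 * √r)⁻¹ * (1 / 2) := by rw [mul_inv]; ring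
      _ ≤ Real.log (r + 1) ^ (β - 1) * (r / (r + 1)) :=
        mul_le_mul h1 (half_le_div_add zero_le_one hr0 hr1) (by norm_num) (by positivity)
  · filter_upwards [hlog1, eventually_gt_atTop 0] with r hl hr0
    rw [logTerm_ofReal β hr0, Complex.ofReal_re]
    exact mul_le_one₀ (rpow_le_one_of_one_le_of_nonpos hl (by linarith)) (by positivity)
      (by rw [div_le_one (by linarith)]; linarith)
  · have h1 : Tendsto (fun s : ℂ => Complex.log (s + 1) / (Real.log (‖s‖ + 1) : ℂ))
        halfPlaneInfty (𝓝 1) := by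
      have := tendsto_log_iterate_div zero_le_one 0 fun i hi s hs => by
        obtain rfl : i = 0 := by omega
        simpa using Complex.slitPlane_ne_zero (add_one_mem_slitPlane hs)
      simpa using this
    -- The power of a quotient tending to one, with the power taken through logarithms.
    have h2 : Tendsto (fun s : ℂ => Complex.exp (Complex.log (Complex.log (s + 1) /
        (Real.log (‖s‖ + 1) : ℂ)) * ((β - 1 : ℝ) : ℂ))) halfPlaneInfty (𝓝 1) := by
      have h3 := ((continuousAt_clog (x := 1) (by simp)).tendsto.comp h1).mul_const
        ((β - 1 : ℝ) : ℂ)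
      rw [Complex.log_one, zero_mul] at h3
      have := (Complex.continuous_exp.tendsto 0).comp h3
      rwa [Complex.exp_zero] at this
    have h4 := h2.mul ((tendsto_div_add_halfPlaneInfty 1).div
      (tendsto_norm_div_add_halfPlaneInfty 1) one_ne_zero)
    rw [div_one, mul_one] at h4
    refine h4.congr' ?_
    filter_upwards [eventually_mem_halfPlane] with s hs
    have hn := norm_pos_of_mem_halfPlane hs
    have hl := log_add_one_pos hn
    have hl' : (Real.log (‖s‖ + 1) : ℂ) ≠ 0 := by exact_mod_cast hl.ne'
    have hz : Complex.log (s + 1) ≠ 0 := fun h => by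
      have := log_add_one_re_pos hs
      simp [h] at this
    rw [logTerm, logTerm, log_add_one_ofReal hn, mul_div_mul_comm, Complex.ofReal_one]
    congr 1
    rw [Complex.cpow_def_of_ne_zero hz, Complex.cpow_def_of_ne_zero hl', ← Complex.exp_sub,
      ← sub_mul]
    congr 2
    have h5 := Complex.log_ofReal_mul hl (div_ne_zero hz hl')
    rw [mul_div_cancel₀ _ hl'] at h5
    rw [h5, ← Complex.ofReal_log hl.le]
    ring

lemma denjoy_ofReal (α : ℕ →₀ ℝ) {r : ℝ} (hr : 0 < r) : denjoy α r =
    ((exp (Real.log (r + 1) ^ α 0) * ∏ k ∈ α.support.erase 0,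
      (Real.log)^[k] (r + (Real.exp)^[k] 1) ^ α k : ℝ) : ℂ) := by
  rw [denjoy, log_add_one_ofReal hr, Complex.ofReal_mul, Complex.ofReal_exp,
    Complex.ofReal_cpow (log_add_one_pos hr).le, Complex.ofReal_prod]
  congr 1
  refine Finset.prod_congr rfl fun k _ => ?_
  have h := one_lt_log_iterate (le_refl k) (x := r + (Real.exp)^[k] 1) (by linarith)
  rw [log_iterate_add_ofReal le_rfl hr, Complex.ofReal_cpow (zero_le_one.trans h.le)]

lemma trace_denjoy (α : ℕ →₀ ℝ) {r : ℝ} (hr : 0 < r) : trace (denjoy α) r =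
    exp (Real.log (r + 1) ^ α 0) * ∏ k ∈ α.support.erase 0,
      (Real.log)^[k] (r + (Real.exp)^[k] 1) ^ α k := by
  rw [trace, denjoy_ofReal α hr, Complex.ofReal_re]

section

variable {α : ℕ →₀ ℝ}

lemma one_le_denjoy_factor (hα : ∀ k, 0 ≤ α k) {r : ℝ} (hr : 0 < r) (k : ℕ) :
    1 ≤ (Real.log)^[k] (r + (Real.exp)^[k] 1) ^ α k :=
  one_le_rpow (one_lt_log_iterate (le_refl k) (by linarith)).le (hα k)

lemma one_le_exp_log_rpow (β : ℝ) {r : ℝ} (hr : 0 < r) : 1 ≤ exp (Real.log (r + 1) ^ β) :=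
  one_le_exp (rpow_nonneg (log_add_one_pos hr).le _)

lemma one_le_trace_denjoy (hα : ∀ k, 0 ≤ α k) {r : ℝ} (hr : 0 < r) :
    1 ≤ trace (denjoy α) r := by
  rw [trace_denjoy α hr]
  exact one_le_mul_of_one_le_of_one_le (one_le_exp_log_rpow _ hr)
    (Finset.one_le_prod fun k _ => one_le_denjoy_factor hα hr k)

lemma tendsto_trace_denjoy (hα : ∀ k, 0 ≤ α k) (hα0 : α ≠ 0) :
    Tendsto (trace (denjoy α)) atTop atTop := by
  obtain ⟨k, hk⟩ := Finsupp.ne_iff.1 hα0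
  have hkpos : 0 < α k := lt_of_le_of_ne (hα k) (Ne.symm (by simpa using hk))
  rcases eq_or_ne k 0 with rfl | hk0
  · refine tendsto_atTop_mono' _ ?_ (tendsto_exp_atTop.comp ((tendsto_rpow_atTop hkpos).comp
      (tendsto_log_atTop.comp (tendsto_atTop_add_const_right _ (1 : ℝ) tendsto_id))))
    filter_upwards [eventually_gt_atTop 0] with r hr
    rw [trace_denjoy α hr]
    exact le_mul_of_one_le_right (exp_pos _).le
      (Finset.one_le_prod fun k _ => one_le_denjoy_factor hα hr k)
  · refine tendsto_atTop_mono' _ ?_ ((tendsto_rpow_atTop hkpos).comp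
      ((tendsto_log_iterate_atTop k).comp
        (tendsto_atTop_add_const_right _ ((Real.exp)^[k] 1) tendsto_id)))
    filter_upwards [eventually_gt_atTop 0] with r hr
    have hmem : k ∈ α.support.erase 0 :=
      Finset.mem_erase.2 ⟨hk0, Finsupp.mem_support_iff.2 hkpos.ne'⟩
    have h1 : (1 : ℝ) ≤ ∏ j ∈ (α.support.erase 0).erase k,
        (Real.log)^[j] (r + (Real.exp)^[j] 1) ^ α j :=
      Finset.one_le_prod fun k _ => one_le_denjoy_factor hα hr k
    have h2 : 0 ≤ (Real.log)^[k] (r + (Real.exp)^[k] 1) ^ α k :=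
      zero_le_one.trans (one_le_denjoy_factor hα hr k)
    rw [trace_denjoy α hr, ← Finset.mul_prod_erase _ _ hmem]
    simp only [Function.comp_apply, id]
    exact (le_mul_of_one_le_right h2 h1).trans (le_mul_of_one_le_left
      (mul_nonneg h2 (zero_le_one.trans h1)) (one_le_exp_log_rpow _ hr))

end

lemma one_lt_denjoy_log_re (k : ℕ) {s : ℂ} (hs : s ∈ halfPlane) :
    1 < ((Complex.log)^[k] (s + (((Real.exp)^[k] 1 : ℝ) : ℂ))).re :=
  one_lt_log_iterate_re le_rfl (exp_iterate_lt_add hs)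

lemma hasDerivAt_denjoy_factor (β : ℂ) (k : ℕ) {s : ℂ} (hs : s ∈ halfPlane) :
    HasDerivAt (fun s : ℂ => ((Complex.log)^[k] (s + (((Real.exp)^[k] 1 : ℝ) : ℂ))) ^ β)
      (β * ((Complex.log)^[k] (s + (((Real.exp)^[k] 1 : ℝ) : ℂ))) ^ (β - 1) *
        ∏ i ∈ Finset.range k, ((Complex.log)^[i] (s + (((Real.exp)^[k] 1 : ℝ) : ℂ)))⁻¹) s :=
  ((hasDerivAt_log_iterate le_rfl (exp_iterate_lt_add hs)).comp_add_const s _).cpow_const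
    (mem_slitPlane_of_one_lt_re (one_lt_denjoy_log_re k hs))

lemma hasDerivAt_denjoy_exp (β : ℂ) {s : ℂ} (hs : s ∈ halfPlane) :
    HasDerivAt (fun s : ℂ => Complex.exp (Complex.log (s + 1) ^ β))
      (Complex.exp (Complex.log (s + 1) ^ β) *
        (β * Complex.log (s + 1) ^ (β - 1) * (1 / (s + 1)))) s :=
  ((((hasDerivAt_id s).add_const 1).clog (add_one_mem_slitPlane hs)).cpow_const
    (Or.inl (log_add_one_re_pos hs))).cexp

lemma denjoy_factor_ne_zero (β : ℂ) (k : ℕ) {s : ℂ} (hs : s ∈ halfPlane) :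
    ((Complex.log)^[k] (s + (((Real.exp)^[k] 1 : ℝ) : ℂ))) ^ β ≠ 0 := by
  rw [Complex.cpow_def_of_ne_zero (ne_zero_of_one_lt_re (one_lt_denjoy_log_re k hs))]
  exact Complex.exp_ne_zero _

lemma differentiableOn_denjoy (α : ℕ →₀ ℝ) : DifferentiableOn ℂ (denjoy α) halfPlane :=
  fun _ hs => ((hasDerivAt_denjoy_exp _ hs).differentiableAt.mul
    (DifferentiableAt.fun_finsetProd fun k _ =>
      (hasDerivAt_denjoy_factor _ k hs).differentiableAt)).differentiableWithinAt

lemma denjoy_ne_zero (α : ℕ →₀ ℝ) {s : ℂ} (hs : s ∈ halfPlane) : denjoy α s ≠ 0 :=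
  mul_ne_zero (Complex.exp_ne_zero _)
    (Finset.prod_ne_zero_iff.2 fun k _ => denjoy_factor_ne_zero _ k hs)

lemma mul_logDeriv_denjoy_factor (β : ℂ) (k : ℕ) {s : ℂ} (hs : s ∈ halfPlane) :
    s * logDeriv (fun s : ℂ => ((Complex.log)^[k] (s + (((Real.exp)^[k] 1 : ℝ) : ℂ))) ^ β) s =
      β * iterTerm k s := by
  have h0 := ne_zero_of_one_lt_re (one_lt_denjoy_log_re k hs)
  have h1 := denjoy_factor_ne_zero β k hs
  rw [logDeriv_apply, (hasDerivAt_denjoy_factor β k hs).deriv, Complex.cpow_sub _ _ h0,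
    Complex.cpow_one]
  have h2 : (s + (((Real.exp)^[k] 1 : ℝ) : ℂ))⁻¹ *
      ∏ i ∈ Finset.range k, ((Complex.log)^[i + 1] (s + (((Real.exp)^[k] 1 : ℝ) : ℂ)))⁻¹ =
      (∏ i ∈ Finset.range k, ((Complex.log)^[i] (s + (((Real.exp)^[k] 1 : ℝ) : ℂ)))⁻¹) *
        ((Complex.log)^[k] (s + (((Real.exp)^[k] 1 : ℝ) : ℂ)))⁻¹ := by
    rw [← Finset.prod_range_succ, Finset.prod_range_succ', mul_comm]
    rfl
  rw [iterTerm, div_eq_mul_inv s, mul_assoc s, h2]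
  field_simp

lemma eps_denjoy (α : ℕ →₀ ℝ) {s : ℂ} (hs : s ∈ halfPlane) : eps (denjoy α) s =
    ∑ k ∈ α.support, (α k : ℂ) * (if k = 0 then logTerm (α 0) else iterTerm k) s := by
  have h1 : eps (denjoy α) s = s * logDeriv (denjoy α) s := by
    rw [eps, logDeriv_apply, mul_div_assoc]
  have h2 : logDeriv (denjoy α) s =
      logDeriv (fun s : ℂ => Complex.exp (Complex.log (s + 1) ^ ((α 0 : ℝ) : ℂ))) s +
      ∑ k ∈ α.support.erase 0, logDeriv
        (fun s : ℂ => ((Complex.log)^[k] (s + (((Real.exp)^[k] 1 : ℝ) : ℂ))) ^ ((α k : ℝ) : ℂ))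
        s := by
    rw [← logDeriv_prod (f := fun k (s : ℂ) =>
        ((Complex.log)^[k] (s + (((Real.exp)^[k] 1 : ℝ) : ℂ))) ^ ((α k : ℝ) : ℂ))
        (fun k _ => denjoy_factor_ne_zero _ k hs)
      fun k _ => (hasDerivAt_denjoy_factor _ k hs).differentiableAt]
    exact logDeriv_mul s (Complex.exp_ne_zero _)
      (Finset.prod_ne_zero_iff.2 fun k _ => denjoy_factor_ne_zero _ k hs)
      (hasDerivAt_denjoy_exp _ hs).differentiableAt
      (DifferentiableAt.fun_finsetProd fun k _ =>
        (hasDerivAt_denjoy_factor _ k hs).differentiableAt)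
  have h3 : s * logDeriv (fun s : ℂ => Complex.exp (Complex.log (s + 1) ^ ((α 0 : ℝ) : ℂ))) s =
      (α 0 : ℂ) * logTerm (α 0) s := by
    rw [logDeriv_apply, (hasDerivAt_denjoy_exp _ hs).deriv,
      mul_div_cancel_left₀ _ (Complex.exp_ne_zero _), logTerm]
    push_cast
    ring
  have h4 : ∑ k ∈ α.support.erase 0, s * logDeriv
        (fun s : ℂ => ((Complex.log)^[k] (s + (((Real.exp)^[k] 1 : ℝ) : ℂ))) ^ ((α k : ℝ) : ℂ))
        s = ∑ k ∈ α.support.erase 0,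
          (α k : ℂ) * (if k = 0 then logTerm (α 0) else iterTerm k) s :=
    Finset.sum_congr rfl fun k hk => by
      rw [mul_logDeriv_denjoy_factor _ k hs, if_neg (Finset.ne_of_mem_erase hk)]
  rw [h1, h2, mul_add, h3, Finset.mul_sum, h4]
  by_cases h0 : 0 ∈ α.support
  · rw [← Finset.add_sum_erase _ _ h0, if_pos rfl]
  · rw [Finset.erase_eq_of_notMem h0, Finsupp.notMem_support_iff.1 h0]
    simp

theorem isHalfPlaneWeight_of_isDenjoyWeight (hL : IsDenjoyWeight L) : IsHalfPlaneWeight L := by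
  obtain ⟨α, hα, hα1, hα0, rfl⟩ := hL
  refine isHalfPlaneWeight_of_eps_eq_sum
    (fun r hr => by rw [denjoy_ofReal α hr, Complex.ofReal_im])
    (fun r hr => one_le_trace_denjoy hα hr) (tendsto_trace_denjoy hα hα0)
    (differentiableOn_denjoy α) (fun s hs => denjoy_ne_zero α hs)
    (fun k hk => lt_of_le_of_ne (hα k) (Finsupp.mem_support_iff.1 hk).symm)
    (Finsupp.support_nonempty_iff.2 hα0) (fun k _ => ?_) (fun s hs => eps_denjoy α hs)
  split_ifs
  exacts [isSlowTerm_logTerm (hα 0) hα1, isSlowTerm_iterTerm k]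

end RegularTransform

theorem theorem1 (L : ℂ → ℂ)
    (hL : RegularTransform.IsDenjoyWeight L ∨
      ∃ a : ℝ, π / 2 < a ∧ a ≤ π ∧ RegularTransform.IsWeight a L ∧
        RegularTransform.R3 L ∧ RegularTransform.R8 a L)
    (I : Set ℝ) (hI : I.OrdConnected) (hI0 : (0 : ℝ) ∈ I) (hInt : I.Nontrivial)
    (hIpos : IsOpen (I ∩ Ioi 0)) (hIneg : IsOpen (I ∩ Iio 0))
    (c : ℝ) (hc : 0 < c) :
    Complex.VerticalIntegrable (RegularTransform.gam L) c ∧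
      ∀ F ∈ RegularTransform.classA (RegularTransform.trace L) I,
        (∀ x ∈ I, IntegrableOn
          (fun t : ℝ => F ((x * t : ℝ) : ℂ) * RegularTransform.kernel L c t) (Ioi 0)) ∧
        RegularTransform.regularTransform L c F ∈
          RegularTransform.beurlingClass (RegularTransform.trace L) I := by
  have hW : RegularTransform.IsHalfPlaneWeight L := by
    rcases hL with h | ⟨a, ha, -, h, h3, h8⟩
    · exact RegularTransform.isHalfPlaneWeight_of_isDenjoyWeight h
    · exact RegularTransform.isHalfPlaneWeight_of_isWeight ha h h3 h8
  refine ⟨RegularTransform.verticalIntegrable_gam hW hc, fun F hF => ⟨fun x hx => ?_,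
    RegularTransform.regularTransform_mem_beurlingClass hW hI hI0 hInt hIpos hIneg hF hc⟩⟩
  have h : RegularTransform.derivIntegrand L c F 0 x =
      fun t : ℝ => F ((x * t : ℝ) : ℂ) * RegularTransform.kernel L c t := by
    ext t
    simp [RegularTransform.derivIntegrand]
  rw [← h]
  exact RegularTransform.integrableOn_derivIntegrand hW hI hI0 hIpos hIneg hF hc 0 hx

end
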